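/- Let $n \ge 3$, let $\mathfrak{S}_n$ be the symmetric group (the Coxeter group of type $A_{n-1}$), with permutations composed from right to left, and let $T$ be its set of transpositions. For $w \in \mathfrak{S}_n$ let $\ell_T(w)$ be the least number of elements of $T$ whose product is $w$, and write $u \le_T v$ if $\ell_T(v) = \ell_T(u) + \ell_T(u^{-1}v)$. Let $c$ be a Coxeter element of $\mathfrak{S}_n$, that is, an $n$-cycle, for example $c = (1\ 2\ \cdots\ n)$, and let $NC(\mathfrak{S}_n,c) = \{w \in \mathfrak{S}_n : e \le_T w \le_T c\}$, which is a lattice under $\le_T$. Put $$\pi_T(w) = \bigvee_{t \in T,\ t \le_T w} t \quad \text{(join in } NC(\mathfrak{S}_n,c)), \qquad \mathrm{Pop}_T(w) = w \cdot \pi_T(w)^{-1}.$$ Say that $w$ requires exactly $k$ iterations of $\mathrm{Pop}_T$ to reach the identity if $k$ is the least integer $m \ge 0$ with $\mathrm{Pop}_T^m(w) = e$. Then the number of permutations $w \in \mathfrak{S}_n$ that require exactly $n-2$ or exactly $n-1$ iterations of $\mathrm{Pop}_T$ to reach the identity is $$2^n - \binom{n}{2}.$$ -/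

import Mathlib

namespace PopTsack

/-- The set `T` of reflections of the symmetric group: the transpositions. -/
def reflections (n : ℕ) : Set (Equiv.Perm (Fin n)) :=
  {t | t.IsSwap}

/-- The absolute length `ℓ_T(w)`: the least length of a word in the reflections with product `w`.
The transpositions generate the symmetric group, so the set below is never empty. -/
noncomputable def absLength {n : ℕ} (w : Equiv.Perm (Fin n)) : ℕ :=
  sInf {k | ∃ l : List (Equiv.Perm (Fin n)),
    l.length = k ∧ (∀ t ∈ l, t ∈ reflections n) ∧ l.prod = w}

/-- The absolute order `u ≤_T v`. -/
def AbsLE {n : ℕ} (u v : Equiv.Perm (Fin n)) : Prop :=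
  absLength v = absLength u + absLength (u⁻¹ * v)

/-- The noncrossing partitions `NC(𝔖_n, c) = [e, c]`, an interval of the absolute order. -/
def NC {n : ℕ} (c : Equiv.Perm (Fin n)) : Set (Equiv.Perm (Fin n)) :=
  {w | AbsLE 1 w ∧ AbsLE w c}

/-- `v` lies in `NC(𝔖_n, c)` and is above every reflection `t ≤_T w`. -/
def IsNCUpperBound {n : ℕ} (c w v : Equiv.Perm (Fin n)) : Prop :=
  v ∈ NC c ∧ ∀ t ∈ reflections n, AbsLE t w → AbsLE t v

/-- `v` is the join, in `NC(𝔖_n, c)`, of all reflections `t ≤_T w`. -/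
def IsNCJoin {n : ℕ} (c w v : Equiv.Perm (Fin n)) : Prop :=
  IsNCUpperBound c w v ∧ ∀ u, IsNCUpperBound c w u → AbsLE v u

open Classical in
/-- The noncrossing projection `π_T(w, c)`, the join in `NC(𝔖_n, c)` of all reflections
`t ≤_T w`. For a Coxeter element `c` the join always exists and is unique, because `NC(𝔖_n, c)`
is a lattice containing all reflections; the default value is then never used. -/
noncomputable def ncProj {n : ℕ} (c w : Equiv.Perm (Fin n)) : Equiv.Perm (Fin n) :=
  if h : ∃ v, IsNCJoin c w v then h.choose else 1

/-- The Coxeter pop-tsack torsing operator `Pop_T(w, c) = w · π_T(w, c)⁻¹`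
(permutations are composed from right to left). -/
noncomputable def popT {n : ℕ} (c w : Equiv.Perm (Fin n)) : Equiv.Perm (Fin n) :=
  w * (ncProj c w)⁻¹

/-- `w` requires exactly `k` iterations of `Pop_T` to reach the identity. -/
def RequiresExactly {n : ℕ} (c w : Equiv.Perm (Fin n)) (k : ℕ) : Prop :=
  IsLeast {m : ℕ | (popT c)^[m] w = 1} k

end PopTsack

namespace PopTsack

open Equiv Equiv.Perm

variable {n m : ℕ}

/-! ### The absolute length of a permutation -/

/-! All `n`-cycles are conjugate and `popT` respects conjugation, so one may take `c = finRotate (m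
+ 1)` with `n = m + 1`. Then `NC` is the lattice of noncrossing partitions: a partition corresponds
to the permutation moving each element to the next one of its block (`Adapted`), and `AbsLE` to
refinement. Hence `ncProj c w = nextPerm (ncClosure w)`. For inverses the dynamics reads: token `j`,
whose home is `j`, sits at position `u j`, and `torse` advances every token to the next position of
its block in the noncrossing closure.

Closures only get finer, and a token at home stays there. Token `Fin.last m` moves strictly to the
right until it is home, hence needs at most `m` steps; rotation by `c` transfers this bound to all
tokens. It remains to count the `u` with `torse^[m - 2] u ≠ 1`.

For such `u`, up to rotation, the last token is still away at time `m - 2`. It has visited `m - 1`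
of the `m` positions before its home, so it misses exactly one, `x`; all other positions ahead of it
lie in its block. A token `j ≠ x` ahead of it with `u j ≤ j` could then never be overtaken, which is
absurd. So `c⁻¹ * u` has at most one descent and is the increasing cycle on a set `S`
(`exists_isSlowSet_of_last_ne`). A pair `S` that is not cyclically adjacent is impossible, since it
would cut off two positions from the last token.

Conversely, for every other `S`, invariants on the tokens ahead of a suitably chosen last token show
that it skips at most one position (`torse_iterate_last_ne_of_mem`,
`torse_iterate_last_ne_of_notMem`). Singletons give the same permutation as the empty set, so the
count is `2 ^ n - n - (n.choose 2 - n)`. -/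

lemma exists_word (w : Perm (Fin n)) :
    ∃ l : List (Perm (Fin n)), (∀ t ∈ l, t ∈ reflections n) ∧ l.prod = w := by
  obtain ⟨l, hl, hs⟩ := (truncSwapFactors w).out
  exact ⟨l, hs, hl⟩

lemma exists_word_length_eq (w : Perm (Fin n)) :
    ∃ l : List (Perm (Fin n)),
      l.length = absLength w ∧ (∀ t ∈ l, t ∈ reflections n) ∧ l.prod = w := by
  obtain ⟨l, hs, hl⟩ := exists_word w
  exact Nat.sInf_mem (s := {k | ∃ l : List (Perm (Fin n)),
    l.length = k ∧ (∀ t ∈ l, t ∈ reflections n) ∧ l.prod = w}) ⟨l.length, l, rfl, hs, hl⟩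

lemma absLength_le_length {w : Perm (Fin n)} {l : List (Perm (Fin n))}
    (hs : ∀ t ∈ l, t ∈ reflections n) (hl : l.prod = w) : absLength w ≤ l.length :=
  Nat.sInf_le ⟨l, rfl, hs, hl⟩

lemma absLength_one : absLength (1 : Perm (Fin n)) = 0 :=
  Nat.le_zero.1 (absLength_le_length (l := []) (by simp) rfl)

lemma eq_one_of_absLength_eq_zero {w : Perm (Fin n)} (h : absLength w = 0) : w = 1 := by
  obtain ⟨l, hl, -, rfl⟩ := exists_word_length_eq w
  rw [h, List.length_eq_zero_iff] at hl
  simp [hl]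

lemma absLength_mul_le (u v : Perm (Fin n)) :
    absLength (u * v) ≤ absLength u + absLength v := by
  obtain ⟨l, hl, hs, hp⟩ := exists_word_length_eq u
  obtain ⟨l', hl', hs', hp'⟩ := exists_word_length_eq v
  rw [← hl, ← hl', ← List.length_append]
  refine absLength_le_length (fun t ht => ?_) (by rw [List.prod_append, hp, hp'])
  rcases List.mem_append.1 ht with h | h
  exacts [hs t h, hs' t h]

lemma swap_mem_reflections {i j : Fin n} (h : i ≠ j) : swap i j ∈ reflections n :=
  ⟨i, j, h, rfl⟩

lemma sign_eq_pow_absLength (w : Perm (Fin n)) : sign w = (-1) ^ absLength w := by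
  obtain ⟨l, hl, hs, hp⟩ := exists_word_length_eq w
  rw [← hl, ← hp]
  exact sign_prod_list_swap hs

lemma absLength_swap_le {i j : Fin n} (h : i ≠ j) : absLength (swap i j) ≤ 1 :=
  absLength_le_length (l := [swap i j]) (by simpa using swap_mem_reflections h) (by simp)

lemma absLength_swap {i j : Fin n} (h : i ≠ j) : absLength (swap i j) = 1 := by
  have h1 := absLength_swap_le h
  rcases Nat.lt_or_ge 0 (absLength (swap i j)) with h0 | h0
  · omega
  · have := eq_one_of_absLength_eq_zero (Nat.le_zero.1 h0)
    exact absurd this (by simpa [swap_eq_one_iff] using h)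

lemma absLength_swap_mul_ne {i j : Fin n} (h : i ≠ j) (w : Perm (Fin n)) :
    absLength (swap i j * w) ≠ absLength w := by
  intro he
  have h1 := sign_eq_pow_absLength (swap i j * w)
  rw [he, ← sign_eq_pow_absLength, Perm.sign_mul, sign_swap h] at h1
  rcases Int.units_eq_one_or (sign w) with h2 | h2 <;> rw [h2] at h1 <;> exact absurd h1 (by decide)

/-- The functions fixed by `w`. -/
def fixedFunctions (w : Perm (Fin n)) : Submodule ℚ (Fin n → ℚ) where
  carrier := {f | ∀ i, f (w i) = f i}
  add_mem' := fun {f g} hf hg i => by simp [hf i, hg i]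
  zero_mem' := fun _ => rfl
  smul_mem' := fun a f hf i => by simp [hf i]

lemma mem_fixedFunctions {w : Perm (Fin n)} {f : Fin n → ℚ} :
    f ∈ fixedFunctions w ↔ ∀ i, f (w i) = f i := Iff.rfl

lemma mem_fixedFunctions_swap {i j : Fin n} {f : Fin n → ℚ} :
    f ∈ fixedFunctions (swap i j) ↔ f i = f j := by
  refine ⟨fun h => by simpa using h j, fun h k => ?_⟩
  rcases eq_or_ne k i with rfl | hi
  · simp [h]
  rcases eq_or_ne k j with rfl | hj
  · simp [h]
  · rw [swap_apply_of_ne_of_ne hi hj]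

lemma inf_fixedFunctions_le (u v : Perm (Fin n)) :
    fixedFunctions u ⊓ fixedFunctions v ≤ fixedFunctions (u * v) := by
  rintro f ⟨hu, hv⟩ i
  rw [Perm.mul_apply, hu, hv]

lemma apply_eq_of_sameCycle {w : Perm (Fin n)} {f : Fin n → ℚ} (hf : f ∈ fixedFunctions w)
    {i j : Fin n} (h : w.SameCycle i j) : f i = f j := by
  obtain ⟨k, rfl⟩ := h.exists_nat_pow_eq
  induction k with
  | zero => rfl
  | succ k ih =>
    rw [pow_succ', Perm.mul_apply, hf]
    exact ih ⟨k, by simp⟩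

lemma finrank_le_finrank_inf_swap_add_one (V : Submodule ℚ (Fin n → ℚ)) (i j : Fin n) :
    Module.finrank ℚ V
      ≤ Module.finrank ℚ (V ⊓ fixedFunctions (swap i j) : Submodule ℚ (Fin n → ℚ)) + 1 := by
  let φ : V →ₗ[ℚ] ℚ := ((LinearMap.proj i : (Fin n → ℚ) →ₗ[ℚ] ℚ) - LinearMap.proj j).domRestrict V
  have h1 := φ.finrank_range_add_finrank_ker
  have h2 : Module.finrank ℚ (LinearMap.range φ) ≤ 1 := by
    simpa using (LinearMap.range φ).finrank_le
  have h3 : (LinearMap.ker φ).map V.subtype = V ⊓ fixedFunctions (swap i j) := by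
    ext f
    simp only [Submodule.mem_map, LinearMap.mem_ker, Submodule.mem_inf, mem_fixedFunctions_swap]
    constructor
    · rintro ⟨⟨g, hg⟩, h, rfl⟩
      exact ⟨hg, sub_eq_zero.1 h⟩
    · rintro ⟨hf, h⟩
      exact ⟨⟨f, hf⟩, sub_eq_zero.2 h, rfl⟩
  have h4 := Submodule.finrank_map_subtype_eq V (LinearMap.ker φ)
  rw [h3] at h4
  omega

lemma le_length_add_finrank (l : List (Perm (Fin n))) (hs : ∀ t ∈ l, t ∈ reflections n) :
    n ≤ l.length + Module.finrank ℚ (fixedFunctions l.prod) := by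
  induction l with
  | nil =>
    have : fixedFunctions (1 : Perm (Fin n)) = ⊤ := by
      ext f; simp [mem_fixedFunctions]
    rw [List.prod_nil, this]; simp
  | cons t l ih =>
    have h1 := ih fun s hs' => hs s (List.mem_cons_of_mem _ hs')
    obtain ⟨i, j, hij, rfl⟩ := hs t List.mem_cons_self
    have h2 := finrank_le_finrank_inf_swap_add_one (fixedFunctions l.prod) i j
    have h3 := Submodule.finrank_mono
      ((inf_comm _ _).le.trans (inf_fixedFunctions_le (swap i j) l.prod))
    rw [List.prod_cons, List.length_cons]
    omega

lemma fixedFunctions_le_swap_mul {w : Perm (Fin n)} {i j : Fin n} (h : w.SameCycle i j) :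
    fixedFunctions w ≤ fixedFunctions (swap i j * w) := fun _ hf =>
  inf_fixedFunctions_le _ _ ⟨mem_fixedFunctions_swap.2 (apply_eq_of_sameCycle hf h), hf⟩

/-- Greedy factorization: multiplying by `swap i (w i)` turns the moved point `i` into a fixed
point, which strictly enlarges the space of fixed functions. -/
lemma absLength_add_finrank_le (w : Perm (Fin n)) :
    absLength w + Module.finrank ℚ (fixedFunctions w) ≤ n := by
  induction hk : n - Module.finrank ℚ (fixedFunctions w) using Nat.strong_induction_on
    generalizing w with
  | _ k ih =>
    have hle : Module.finrank ℚ (fixedFunctions w) ≤ n := by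
      simpa using (fixedFunctions w).finrank_le
    by_cases hw : w = 1
    · rw [hw, absLength_one, ← hw]; omega
    obtain ⟨i, hi⟩ : ∃ i, w i ≠ i := by
      by_contra! h
      exact hw (Equiv.ext h)
    have hlt : fixedFunctions w < fixedFunctions (swap i (w i) * w) := by
      refine lt_of_le_of_ne (fixedFunctions_le_swap_mul (sameCycle_apply_right.2 (.refl _ _))) ?_
      intro he
      -- The indicator of `i` witnesses strictness: it is fixed by the new permutation but not by
      -- `w`.
      have h1 : (Pi.single i 1 : Fin n → ℚ) ∈ fixedFunctions (swap i (w i) * w) := by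
        intro k
        rcases eq_or_ne k i with rfl | hk
        · simp
        · have : (swap i (w i) * w) k ≠ i := fun h => hk <| by
            have h2 : (swap i (w i) * w) i = i := by simp
            exact (swap i (w i) * w).injective (h.trans h2.symm)
          rw [Pi.single_eq_of_ne hk, Pi.single_eq_of_ne this]
      rw [← he] at h1
      have h2 := h1 i
      simp [Pi.single_eq_of_ne hi] at h2
    have h1 := Submodule.finrank_lt_finrank_of_lt hlt
    have hle' : Module.finrank ℚ (fixedFunctions (swap i (w i) * w)) ≤ n := by
      simpa using (fixedFunctions (swap i (w i) * w)).finrank_le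
    have h2 := ih _ (by omega) (swap i (w i) * w) rfl
    have h3 := absLength_mul_le (swap i (w i)) (swap i (w i) * w)
    rw [swap_mul_self_mul] at h3
    have h4 := absLength_swap_le hi.symm
    omega

lemma absLength_add_finrank (w : Perm (Fin n)) :
    absLength w + Module.finrank ℚ (fixedFunctions w) = n := by
  refine le_antisymm (absLength_add_finrank_le w) ?_
  obtain ⟨l, hl, hs, rfl⟩ := exists_word_length_eq w
  rw [← hl]
  exact le_length_add_finrank l hs

lemma absLength_swap_mul_lt {w : Perm (Fin n)} {i j : Fin n} (hij : i ≠ j)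
    (h : w.SameCycle i j) : absLength (swap i j * w) < absLength w := by
  have h1 := Submodule.finrank_mono (fixedFunctions_le_swap_mul h)
  have h2 := absLength_add_finrank w
  have h3 := absLength_add_finrank (swap i j * w)
  have h4 := absLength_swap_mul_ne hij w
  omega

/-- A transposition across two cycles merges them. Otherwise `w` would map the common part `A` of
the two cycles of `i` injectively into `A` without `i`. -/
lemma sameCycle_swap_mul {w : Perm (Fin n)} {i j : Fin n} (h : ¬ w.SameCycle i j) :
    (swap i j * w).SameCycle i j := by
  classical
  by_contra h'
  set v := swap i j * w with hv
  let A : Finset (Fin n) := Finset.univ.filter fun k => w.SameCycle i k ∧ v.SameCycle i k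
  have hA : ∀ k ∈ A, w k ∈ A.erase i := by
    intro k hk
    simp only [A, Finset.mem_filter, Finset.mem_univ, true_and, Finset.mem_erase] at hk ⊢
    have h1 : w.SameCycle i (w k) := sameCycle_apply_right.2 hk.1
    have h2 : v.SameCycle i (v k) := sameCycle_apply_right.2 hk.2
    have h3 : w k ≠ j := fun e => h (e ▸ h1)
    have h4 : w k ≠ i := fun e => h' <| by
      have : v k = j := by simp [hv, e]
      exact this ▸ h2
    have h5 : v k = w k := by simp [hv, swap_apply_of_ne_of_ne h4 h3]
    exact ⟨h4, h1, h5 ▸ h2⟩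
  have h1 := Finset.card_le_card_of_injOn w hA w.injective.injOn
  have h2 : i ∈ A := by simp [A, SameCycle.refl]
  have h3 := Finset.card_erase_lt_of_mem h2
  omega

lemma absLength_lt_swap_mul {w : Perm (Fin n)} {i j : Fin n} (h : ¬ w.SameCycle i j) :
    absLength w < absLength (swap i j * w) := by
  have hij : i ≠ j := fun e => h (e ▸ .refl _ _)
  simpa [swap_mul_self_mul] using absLength_swap_mul_lt hij (sameCycle_swap_mul h)

lemma absLE_swap_iff {w : Perm (Fin n)} {i j : Fin n} (hij : i ≠ j) :
    AbsLE (swap i j) w ↔ w.SameCycle i j := by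
  rw [AbsLE, absLength_swap hij, swap_inv]
  constructor
  · intro h
    by_contra h'
    have := absLength_lt_swap_mul h'
    omega
  · intro h
    have h1 := absLength_swap_mul_lt hij h
    have h2 := absLength_mul_le (swap i j) (swap i j * w)
    rw [swap_mul_self_mul, absLength_swap hij] at h2
    omega

lemma mul_swap_eq (w : Perm (Fin n)) (i j : Fin n) : w * swap i j = swap (w i) (w j) * w := by
  rw [swap_apply_apply]; simp [mul_assoc]

lemma absLength_mul_swap {w : Perm (Fin n)} {i j : Fin n} (hij : i ≠ j)
    (h : w.SameCycle i j) : absLength (w * swap i j) + 1 = absLength w := by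
  have h1 := absLength_swap_mul_lt (w.injective.ne hij)
    (sameCycle_apply_left.2 (sameCycle_apply_right.2 h))
  have h2 := absLength_mul_le (w * swap i j) (swap i j)
  rw [mul_assoc, swap_mul_self, mul_one, absLength_swap hij] at h2
  rw [← mul_swap_eq] at h1
  omega

lemma sameCycle_of_absLength_mul_swap_lt {w : Perm (Fin n)} {i j : Fin n}
    (h : absLength (w * swap i j) < absLength w) : w.SameCycle i j := by
  by_contra h'
  have h1 : ¬ w.SameCycle (w i) (w j) := by
    rwa [sameCycle_apply_left, sameCycle_apply_right]
  have h2 := absLength_lt_swap_mul h1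
  rw [← mul_swap_eq] at h2
  omega

lemma absLE_one (w : Perm (Fin n)) : AbsLE 1 w := by simp [AbsLE, absLength_one]

lemma AbsLE.antisymm {u v : Perm (Fin n)} (h : AbsLE u v) (h' : AbsLE v u) : u = v := by
  unfold AbsLE at h h'
  exact inv_mul_eq_one.1 (eq_one_of_absLength_eq_zero (w := u⁻¹ * v) (by omega))

lemma absLength_conj_le (g w : Perm (Fin n)) : absLength (g * w * g⁻¹) ≤ absLength w := by
  obtain ⟨l, hl, hs, rfl⟩ := exists_word_length_eq w
  rw [← hl, ← List.length_map (MulAut.conj g)]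
  refine absLength_le_length (fun t ht => ?_) (by rw [← map_list_prod]; rfl)
  obtain ⟨s, hs', rfl⟩ := List.mem_map.1 ht
  obtain ⟨i, j, hij, rfl⟩ := hs s hs'
  exact ⟨g i, g j, g.injective.ne hij, by rw [swap_apply_apply]; rfl⟩

lemma absLength_conj (g w : Perm (Fin n)) : absLength (g * w * g⁻¹) = absLength w := by
  refine le_antisymm (absLength_conj_le g w) ?_
  simpa [mul_assoc] using absLength_conj_le g⁻¹ (g * w * g⁻¹)

lemma absLE_conj (g : Perm (Fin n)) {u v : Perm (Fin n)} :
    AbsLE (g * u * g⁻¹) (g * v * g⁻¹) ↔ AbsLE u v := by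
  have : (g * u * g⁻¹)⁻¹ * (g * v * g⁻¹) = g * (u⁻¹ * v) * g⁻¹ := by group
  rw [AbsLE, this, absLength_conj, absLength_conj, absLength_conj, AbsLE]

/-! ### Permutations that move to the next element of a block -/

/-- The permutation `v` sends every element to the next element of its `R`-block,
the blocks being read in increasing order and cyclically. -/
structure Adapted (R : Setoid (Fin n)) (v : Perm (Fin n)) : Prop where
  rel : ∀ a, R a (v a)
  step : ∀ a b, R a b → a < b → a < v a ∧ v a ≤ b

/-- No two blocks of the partition cross. -/
def NonCrossing (R : Setoid (Fin n)) : Prop :=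
  ∀ a b c d, a < b → b < c → c < d → R a c → R b d → R a b

namespace Adapted

variable {R : Setoid (Fin n)} {v : Perm (Fin n)}

/-- The cyclic wrap is not part of `Adapted`; bijectivity forces it. The minimum of a block has a
preimage in the block, and only the maximum does not move up. -/
lemma apply_le (h : Adapted R v) {a b : Fin n} (ha : v a ≤ a) (hab : R a b) : v a ≤ b := by
  have hmax : ∀ j, R a j → j ≤ a := fun j hj => by
    by_contra! hlt
    exact absurd (h.step a j hj hlt).1 (not_lt.2 ha)
  obtain ⟨μ, hμ, hmin⟩ := Set.exists_min_image {y | R a y} id (Set.toFinite _) ⟨a, R.refl a⟩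
  simp only [Set.mem_ofPred_eq, id] at hμ hmin
  have hp : R (v.symm μ) μ := by simpa using h.rel (v.symm μ)
  have hap : R a (v.symm μ) := R.trans hμ (R.symm hp)
  have hle := hmax _ hap
  rcases hle.lt_or_eq with hlt | heq
  · have h1 := (h.step _ a (R.symm hap) hlt).1
    rw [apply_symm_apply] at h1
    exact absurd (hmin _ hap) (not_le.2 h1)
  · rw [← heq, apply_symm_apply]
    exact hmin b hab

lemma unique (h : Adapted R v) {v' : Perm (Fin n)} (h' : Adapted R v') : v = v' := by
  ext a
  by_cases hb : ∃ b, R a b ∧ a < b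
  · obtain ⟨b, hab, hlt⟩ := hb
    have h1 := h.step a _ (h'.rel a) (h'.step a b hab hlt).1
    have h2 := h'.step a _ (h.rel a) (h.step a b hab hlt).1
    exact congrArg _ (le_antisymm h1.2 h2.2)
  · push Not at hb
    exact congrArg _ (le_antisymm (h.apply_le (hb _ (h.rel a)) (h'.rel a))
      (h'.apply_le (hb _ (h'.rel a)) (h.rel a)))

lemma sameCycle_iff (h : Adapted R v) {a b : Fin n} : v.SameCycle a b ↔ R a b := by
  constructor
  · intro hab
    obtain ⟨k, rfl⟩ := hab.exists_nat_pow_eq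
    clear hab
    induction k with
    | zero => exact R.refl _
    | succ k ih =>
      rw [pow_succ', Perm.mul_apply]
      exact R.trans ih (h.rel _)
  · have key : ∀ k : ℕ, ∀ a b : Fin n, (b : ℕ) - a ≤ k → a ≤ b → R a b → v.SameCycle a b := by
      intro k
      induction k with
      | zero =>
        intro a b hk hab _
        have : a = b := by omega
        exact this ▸ .refl _ _
      | succ k ih =>
        intro a b hk hab hR
        rcases hab.eq_or_lt with rfl | hlt
        · exact .refl _ _
        · have h1 := h.step a b hR hlt
          have h2 := ih (v a) b (by omega) h1.2 (R.trans (R.symm (h.rel a)) hR)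
          exact sameCycle_apply_left.1 h2
    intro hR
    rcases le_total a b with hab | hab
    · exact key _ a b le_rfl hab hR
    · exact (key _ b a le_rfl hab (R.symm hR)).symm

end Adapted

lemma exists_adapted (R : Setoid (Fin n)) : ∃ v, Adapted R v := by
  have hf : ∀ i, ∃ y, R i y ∧ (∀ j, R i j → i < j → i < y ∧ y ≤ j) ∧
      ((∀ j, R i j → j ≤ i) → ∀ j, R i j → y ≤ j) := by
    intro i
    by_cases h : ∃ j, R i j ∧ i < j
    · obtain ⟨y, hy, hmin⟩ := Set.exists_min_image {j | R i j ∧ i < j} id (Set.toFinite _) h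
      exact ⟨y, hy.1, fun j hj hlt => ⟨hy.2, hmin j ⟨hj, hlt⟩⟩,
        fun hmax => absurd (hmax y hy.1) (not_le.2 hy.2)⟩
    · obtain ⟨y, hy, hmin⟩ := Set.exists_min_image {j | R i j} id (Set.toFinite _) ⟨i, R.refl i⟩
      exact ⟨y, hy, fun j hj hlt => absurd ⟨j, hj, hlt⟩ h, fun _ j hj => hmin j hj⟩
  choose f hrel hstep hwrap using hf
  have key : ∀ i i', f i = f i' → ¬ i < i' := by
    intro i i' he hlt
    have hii : R i i' := R.trans (hrel i) (he ▸ R.symm (hrel i'))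
    have h1 := hstep i i' hii hlt
    by_cases hmax : ∀ j, R i' j → j ≤ i'
    · have := hwrap i' hmax i (R.symm hii)
      rw [← he] at this
      exact absurd h1.1 (not_lt.2 this)
    · push Not at hmax
      obtain ⟨j, hj, hlt'⟩ := hmax
      have := (hstep i' j hj hlt').1
      rw [← he] at this
      exact absurd h1.2 (not_le.2 this)
  have hinj : Function.Injective f := fun i i' he =>
    le_antisymm (not_lt.1 (key i' i he.symm)) (not_lt.1 (key i i' he))
  exact ⟨Equiv.ofBijective f (Finite.injective_iff_bijective.1 hinj), hrel, hstep⟩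

/-- The permutation sending every element to the next element of its block. -/
noncomputable def nextPerm (R : Setoid (Fin n)) : Perm (Fin n) := (exists_adapted R).choose

lemma adapted_nextPerm (R : Setoid (Fin n)) : Adapted R (nextPerm R) :=
  (exists_adapted R).choose_spec

lemma Adapted.eq_nextPerm {R : Setoid (Fin n)} {v : Perm (Fin n)} (h : Adapted R v) :
    v = nextPerm R := h.unique (adapted_nextPerm R)

lemma adapted_finRotate (m : ℕ) : Adapted (⊤ : Setoid (Fin (m + 1))) (finRotate (m + 1)) where
  rel _ := trivial
  step a b _ hab := by
    have h := coe_finRotate_of_ne_last (i := a) (fun e => by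
      rw [e] at hab; exact absurd (Fin.le_last b) (not_le.2 hab))
    constructor <;> omega

/-! ### Splitting a block in two -/

/-- The partition that splits the block of `i` into its part in `(i, j]` and the rest. -/
def splitBlock (R : Setoid (Fin n)) (i j : Fin n) : Setoid (Fin n) :=
  R ⊓ Setoid.ker fun a => R i a ∧ i < a ∧ a ≤ j

lemma splitBlock_iff {R : Setoid (Fin n)} {i j a b : Fin n} :
    splitBlock R i j a b ↔ R a b ∧ ((R i a ∧ i < a ∧ a ≤ j) ↔ (R i b ∧ i < b ∧ b ≤ j)) := by
  unfold splitBlock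
  rw [Setoid.inf_def]
  simp only [Pi.inf_apply, inf_Prop_eq, Setoid.ker_def, eq_iff_iff]

lemma NonCrossing.splitBlock {R : Setoid (Fin n)} (h : NonCrossing R) (i j : Fin n) :
    NonCrossing (splitBlock R i j) := by
  intro a b c d hab hbc hcd hac hbd
  rw [splitBlock_iff] at *
  have h1 := h a b c d hab hbc hcd hac.1 hbd.1
  refine ⟨h1, ?_⟩
  have e1 : R i a → R i b := fun e => R.trans e h1
  have e2 : R i b → R i a := fun e => R.trans e (R.symm h1)
  have e3 : R i a → R i c := fun e => R.trans e hac.1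
  have e4 : R i b → R i d := fun e => R.trans e hbd.1
  have ⟨_, h2⟩ := hac
  have ⟨_, h3⟩ := hbd
  clear h hac hbd
  constructor
  · rintro ⟨k1, k2, k3⟩
    have := h2.1 ⟨k1, k2, k3⟩
    exact ⟨e1 k1, by omega, by omega⟩
  · rintro ⟨k1, k2, k3⟩
    have := h3.1 ⟨k1, k2, k3⟩
    have := h2.2 ⟨e3 (e2 k1), by omega, by omega⟩
    exact this

/-- The cover relation of the lattice: a transposition inside a block cuts its cyclic order into two
arcs. -/
lemma Adapted.splitBlock {R : Setoid (Fin n)} {v : Perm (Fin n)} (h : Adapted R v)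
    {i j : Fin n} (hij : i < j) (hR : R i j) :
    Adapted (splitBlock R i j) (v * swap i j) := by
  have hvi := h.step i j hR hij
  have hvj : j < v j ∨ v j ≤ i := by
    rcases lt_or_ge j (v j) with h1 | h1
    exacts [.inl h1, .inr (h.apply_le h1 (R.symm hR))]
  constructor
  · intro a
    rw [splitBlock_iff, Perm.mul_apply]
    rcases eq_or_ne a i with rfl | hai
    · rw [swap_apply_left]
      exact ⟨R.trans hR (h.rel j), by constructor <;> rintro ⟨_, _, _⟩ <;> omega⟩
    rcases eq_or_ne a j with rfl | haj
    · rw [swap_apply_right]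
      exact ⟨R.trans (R.symm hR) (h.rel i),
        ⟨fun _ => ⟨h.rel i, hvi⟩, fun _ => ⟨hR, hij, le_rfl⟩⟩⟩
    · rw [swap_apply_of_ne_of_ne hai haj]
      refine ⟨h.rel a, ?_⟩
      have e : R i a ↔ R i (v a) :=
        ⟨fun e => R.trans e (h.rel a), fun e => R.trans e (R.symm (h.rel a))⟩
      rw [← e]
      refine and_congr_right fun hia => ?_
      have h1 := h.step a i (R.symm hia)
      have h2 := h.step a j (R.trans (R.symm hia) hR)
      have h3 : v a ≤ a → v a ≤ i := fun k => h.apply_le k (R.symm hia)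
      constructor
      · rintro ⟨k1, k2⟩
        have := h2 (by omega)
        omega
      · rintro ⟨k1, k2⟩
        omega
  · intro a b hab hlt
    rw [splitBlock_iff] at hab
    rw [Perm.mul_apply]
    rcases eq_or_ne a i with rfl | hai
    · rw [swap_apply_left]
      have : j < b := by
        by_contra! hle
        exact absurd (hab.2.2 ⟨hab.1, hlt, hle⟩).2.1 (lt_irrefl _)
      have := h.step j b (R.trans (R.symm hR) hab.1) this
      omega
    rcases eq_or_ne a j with rfl | haj
    · have := (hab.2.1 ⟨hR, hij, le_rfl⟩).2.2
      omega
    · rw [swap_apply_of_ne_of_ne hai haj]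
      exact h.step a b hab.1 hlt

/-! ### The interval below a noncrossing permutation -/

/-- Descend from `g` to `v` along a shortest word for `v⁻¹ * g`. Each factor lowers the length, so
its two points share a block, and the block splits without creating a crossing. -/
lemma Adapted.exists_of_absLE {g v : Perm (Fin n)} {R : Setoid (Fin n)} (hR : NonCrossing R)
    (hg : Adapted R g) (h : AbsLE v g) : ∃ Q : Setoid (Fin n), NonCrossing Q ∧ Adapted Q v := by
  induction hk : absLength (v⁻¹ * g) generalizing v with
  | zero =>
    obtain rfl : v = g := inv_mul_eq_one.1 (eq_one_of_absLength_eq_zero hk)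
    exact ⟨R, hR, hg⟩
  | succ k ih =>
    obtain ⟨l, hl, hs, hp⟩ := exists_word_length_eq (v⁻¹ * g)
    rw [hk] at hl
    obtain ⟨t, l, rfl⟩ := List.exists_cons_of_length_eq_add_one hl
    obtain ⟨i, j, hij, rfl⟩ := hs t List.mem_cons_self
    have hp' : l.prod = (v * swap i j)⁻¹ * g := by
      rw [mul_inv_rev, swap_inv, mul_assoc, ← hp, List.prod_cons, swap_mul_self_mul]
    have h1 : absLength ((v * swap i j)⁻¹ * g) ≤ k := by
      rw [List.length_cons, add_left_inj] at hl
      rw [← hl]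
      exact absLength_le_length (fun t ht => hs t (List.mem_cons_of_mem _ ht)) hp'
    have h2 := absLength_mul_le (v * swap i j) ((v * swap i j)⁻¹ * g)
    have h3 := absLength_mul_le v (swap i j)
    rw [mul_inv_cancel_left] at h2
    rw [absLength_swap hij] at h3
    unfold AbsLE at h
    obtain ⟨Q, hQ, hQv⟩ := ih (v := v * swap i j) (by unfold AbsLE; omega) (by omega)
    have hlt : absLength (v * swap i j * swap i j) < absLength (v * swap i j) := by
      rw [mul_assoc, swap_mul_self, mul_one]; omega
    have hsc := hQv.sameCycle_iff.1 (sameCycle_of_absLength_mul_swap_lt hlt)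
    have hv : v = v * swap i j * swap i j := by rw [mul_assoc, swap_mul_self, mul_one]
    rcases lt_or_gt_of_ne hij with hlt | hlt
    · refine ⟨_, hQ.splitBlock i j, ?_⟩
      rw [hv]
      exact hQv.splitBlock hlt hsc
    · refine ⟨_, hQ.splitBlock j i, ?_⟩
      rw [hv]
      rw [swap_comm i j] at hQv ⊢
      exact hQv.splitBlock hlt (Q.symm hsc)

/-- The elements strictly between `b` and the next element of its block form a union of blocks. -/
lemma Adapted.mem_gap {R : Setoid (Fin n)} (hR : NonCrossing R) {v : Perm (Fin n)}
    (h : Adapted R v) {b y y' : Fin n} (hy : b < y) (hy' : y < v b) (hyy : R y y') :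
    b < y' ∧ y' < v b := by
  have hb := h.rel b
  have hyb : ¬ R b y := fun e => absurd (h.step b y e hy).2 (not_le.2 hy')
  have h1 : y' ≠ b := fun e => hyb (R.symm (e ▸ hyy))
  have h2 : y' ≠ v b := fun e => hyb (R.trans hb (R.symm (e ▸ hyy)))
  by_contra h3
  rcases lt_or_ge y' b with h4 | h4
  · exact hyb (R.trans (R.symm (hR y' b y (v b) h4 hy hy' (R.symm hyy) hb)) (R.symm hyy))
  · exact hyb (hR b y (v b) y' hy hy' (by omega) hb hyy)

/-- With `j = q⁻¹ (p i)`, the permutation `q * swap i j` agrees with `p` at `i`. Since `P` is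
noncrossing, none of its blocks straddles the cut, so the split of `Q` still lies above `P`. -/
lemma exists_splitBlock {P Q : Setoid (Fin n)} (hP : NonCrossing P) {p q : Perm (Fin n)}
    (hp : Adapted P p) (hq : Adapted Q q) (hPQ : P ≤ Q) {i : Fin n} (hi : p i ≠ q i) :
    (i < q.symm (p i) ∧ P ≤ splitBlock Q i (q.symm (p i))) ∨
      (q.symm (p i) < i ∧ P ≤ splitBlock Q (q.symm (p i)) i) := by
  set j := q.symm (p i) with hj
  have hqj : q j = p i := by simp [hj]
  have hij : i ≠ j := fun e => hi (by rw [← hqj, ← e])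
  have hQij : Q i j := Q.trans (hPQ (hp.rel i)) (Q.symm (hqj ▸ hq.rel j))
  have hsymm : ∀ k l, (∀ y y', P y y' → Q k y → k < y → y ≤ l → k < y' ∧ y' ≤ l) →
      P ≤ splitBlock Q k l := by
    intro k l H y y' hyy
    rw [splitBlock_iff]
    refine ⟨hPQ hyy, fun ⟨h1, h2, h3⟩ => ⟨Q.trans h1 (hPQ hyy), H y y' hyy h1 h2 h3⟩,
      fun ⟨h1, h2, h3⟩ => ⟨Q.trans h1 (hPQ (P.symm hyy)), H y' y (P.symm hyy) h1 h2 h3⟩⟩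
  rcases lt_or_ge i (p i) with hlt | hle
  · have hjp : j < p i := by
      by_contra! hge
      have := hq.apply_le (a := j) (b := i) (by rw [hqj]; exact hge) (Q.symm hQij)
      rw [hqj] at this
      exact absurd hlt (not_lt.2 this)
    have hilt : i < j := by
      by_contra! hge
      have := (hq.step j i (Q.symm hQij) (lt_of_le_of_ne hge hij.symm)).2
      rw [hqj] at this
      exact absurd hlt (not_lt.2 this)
    refine .inl ⟨hilt, hsymm i j fun y y' hyy hQy h1 h2 => ?_⟩
    have h3 := hp.mem_gap hP h1 (h2.trans_lt hjp) hyy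
    refine ⟨h3.1, ?_⟩
    by_contra! h4
    have := (hq.step j y' (Q.trans (Q.symm hQij) (Q.trans hQy (hPQ hyy))) h4).2
    rw [hqj] at this
    exact absurd h3.2 (not_lt.2 this)
  · have hmin : ∀ y, P i y → p i ≤ y := fun y hy => hp.apply_le hle hy
    have hmax : ∀ y, P i y → y ≤ i := fun y hy => by
      by_contra! h
      exact absurd (hp.step i y hy h).1 (not_lt.2 hle)
    rcases lt_or_gt_of_ne hij with hlt | hlt
    · refine .inl ⟨hlt, hsymm i j fun y y' hyy hQy h1 h2 => ?_⟩
      have hjmin : ∀ y, Q j y → p i ≤ y := fun y hy => by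
        have := hq.apply_le (a := j) (by rw [hqj]; omega) hy
        rwa [hqj] at this
      have hjmax : ∀ y, Q j y → y ≤ j := fun y hy => by
        by_contra! h
        have := (hq.step j y hy h).1
        omega
      have hQy' : Q j y' := Q.trans (Q.symm hQij) (Q.trans hQy (hPQ hyy))
      refine ⟨?_, hjmax y' hQy'⟩
      by_contra! hge
      have hne : ¬ P i y := fun e => absurd (hmax y e) (not_le.2 h1)
      have h3 : y' ≠ i := fun e => hne (P.symm (e ▸ hyy))
      have h4 : y' ≠ p i := fun e => hne (P.trans (hp.rel i) (P.symm (e ▸ hyy)))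
      have h5 := hjmin y' hQy'
      have h6 := hP (p i) y' i y (by omega) (by omega) h1 (P.symm (hp.rel i)) (P.symm hyy)
      exact hne (P.trans (hp.rel i) (P.trans h6 (P.symm hyy)))
    · refine .inr ⟨hlt, hsymm j i fun y y' hyy hQy h1 h2 => ?_⟩
      have hjp : j < p i := by
        have := (hq.step j i (Q.symm hQij) hlt).1
        rwa [hqj] at this
      by_cases hPy : P i y
      · have h3 := P.trans hPy hyy
        exact ⟨hjp.trans_le (hmin _ h3), hmax _ h3⟩
      · have h3 : p i ≤ y := by
          have := (hq.step j y hQy h1).2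
          rwa [hqj] at this
        have h4 : y ≠ p i := fun e => hPy (e ▸ hp.rel i)
        have h5 : y ≠ i := fun e => hPy (e ▸ P.refl i)
        by_contra h6
        rcases lt_or_ge j y' with h7 | h7
        · exact hPy (P.trans (hp.rel i) (hP (p i) y i y' (by omega) (by omega) (by omega)
            (P.symm (hp.rel i)) hyy))
        · have h8 := hP y' (p i) y i (by omega) (by omega) (by omega) (P.symm hyy)
            (P.symm (hp.rel i))
          exact hPy (P.trans (hp.rel i) (P.trans (P.symm h8) (P.symm hyy)))

/-- Split blocks of `Q` until `q` becomes `p`: each split costs one transposition and removes at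
least one point of disagreement. -/
lemma Adapted.absLE {P Q : Setoid (Fin n)} (hP : NonCrossing P) {p q : Perm (Fin n)}
    (hp : Adapted P p) (hq : Adapted Q q) (hPQ : P ≤ Q) : AbsLE p q := by
  classical
  induction hk : (Finset.univ.filter fun a => p a ≠ q a).card using Nat.strong_induction_on
    generalizing q Q with
  | _ k ih =>
    by_cases hpq : p = q
    · subst hpq
      simp [AbsLE, absLength_one]
    obtain ⟨i, hi⟩ : ∃ i, p i ≠ q i := by
      by_contra! h
      exact hpq (Equiv.ext h)
    set j := q.symm (p i) with hj
    have hqj : q j = p i := by simp [hj]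
    have hij : i ≠ j := fun e => hi (by rw [← hqj, ← e])
    obtain ⟨Q', hQ', hPQ', hQij⟩ :
        ∃ Q' : Setoid (Fin n), Adapted Q' (q * swap i j) ∧ P ≤ Q' ∧ Q i j := by
      have hQij : Q i j := Q.trans (hPQ (hp.rel i)) (Q.symm (hqj ▸ hq.rel j))
      rcases exists_splitBlock hP hp hq hPQ hi with ⟨h1, h2⟩ | ⟨h1, h2⟩
      · exact ⟨_, hq.splitBlock h1 hQij, h2, hQij⟩
      · refine ⟨_, ?_, h2, hQij⟩
        rw [swap_comm]
        exact hq.splitBlock h1 (Q.symm hQij)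
    have hcard : (Finset.univ.filter fun a => p a ≠ (q * swap i j) a).card < k := by
      rw [← hk]
      refine Finset.card_lt_card (Finset.ssubset_iff_of_subset (fun a ha => ?_) |>.2 ⟨i, ?_, ?_⟩)
      · have ha' : p a ≠ q (swap i j a) := (Finset.mem_filter.1 ha).2
        refine Finset.mem_filter.2 ⟨Finset.mem_univ _, ?_⟩
        rcases eq_or_ne a i with rfl | hai
        · exact hi
        rcases eq_or_ne a j with haj | haj
        · rw [haj, hqj]
          exact p.injective.ne hij.symm
        · rwa [swap_apply_of_ne_of_ne hai haj] at ha'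
      · simpa using hi
      · exact fun h => (Finset.mem_filter.1 h).2 (by simp [hqj])
    have h1 := ih _ hcard hQ' hPQ' rfl
    have h2 := absLength_mul_swap hij (hq.sameCycle_iff.2 hQij)
    have h3 := absLength_mul_le (p⁻¹ * (q * swap i j)) (swap i j)
    rw [← mul_assoc, mul_assoc (p⁻¹ * q), swap_mul_self, mul_one, absLength_swap hij] at h3
    have h4 := absLength_mul_le p (p⁻¹ * q)
    rw [mul_inv_cancel_left] at h4
    unfold AbsLE at h1 ⊢
    rw [← mul_assoc] at h1
    omega

/-! ### The noncrossing closure -/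

/-- The finest noncrossing partition whose blocks are unions of cycles of `w`. -/
def ncClosure (w : Perm (Fin n)) : Setoid (Fin n) :=
  sInf {Q | NonCrossing Q ∧ ∀ i, Q i (w i)}

lemma ncClosure_le {w : Perm (Fin n)} {Q : Setoid (Fin n)} (hQ : NonCrossing Q)
    (h : ∀ i, Q i (w i)) : ncClosure w ≤ Q := sInf_le ⟨hQ, h⟩

lemma ncClosure_iff {w : Perm (Fin n)} {a b : Fin n} :
    ncClosure w a b ↔ ∀ Q : Setoid (Fin n), NonCrossing Q → (∀ i, Q i (w i)) → Q a b :=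
  ⟨fun h Q h1 h2 => h Q ⟨h1, h2⟩, fun h Q hQ => h Q hQ.1 hQ.2⟩

lemma ncClosure_apply (w : Perm (Fin n)) (i : Fin n) : ncClosure w i (w i) :=
  ncClosure_iff.2 fun _ _ h => h i

lemma nonCrossing_ncClosure (w : Perm (Fin n)) : NonCrossing (ncClosure w) := by
  intro a b c d hab hbc hcd hac hbd
  rw [ncClosure_iff] at *
  exact fun Q hQ h => hQ a b c d hab hbc hcd (hac Q hQ h) (hbd Q hQ h)

lemma rel_of_sameCycle {w : Perm (Fin n)} {Q : Setoid (Fin n)} (h : ∀ i, Q i (w i))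
    {i j : Fin n} (hij : w.SameCycle i j) : Q i j := by
  obtain ⟨k, rfl⟩ := hij.exists_nat_pow_eq
  clear hij
  induction k with
  | zero => exact Q.refl _
  | succ k ih =>
    rw [pow_succ', Perm.mul_apply]
    exact Q.trans ih (h _)

lemma ncClosure_inv (w : Perm (Fin n)) : ncClosure w⁻¹ = ncClosure w := by
  have key : ∀ w : Perm (Fin n), ncClosure w⁻¹ ≤ ncClosure w := fun w =>
    ncClosure_le (nonCrossing_ncClosure w) fun i => (ncClosure w).symm <| by
      simpa using ncClosure_apply w (w⁻¹ i)
  exact le_antisymm (key w) (by simpa using key w⁻¹)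

lemma IsNCJoin.unique {c w u v : Perm (Fin n)} (hu : IsNCJoin c w u) (hv : IsNCJoin c w v) :
    u = v := (hu.2 v hv.1).antisymm (hv.2 u hu.1)

lemma IsNCJoin.ncProj_eq {c w v : Perm (Fin n)} (h : IsNCJoin c w v) : ncProj c w = v := by
  have hex : ∃ v, IsNCJoin c w v := ⟨v, h⟩
  unfold ncProj
  rw [dif_pos hex]
  exact hex.choose_spec.unique h

lemma isNCJoin_finRotate (m : ℕ) (w : Perm (Fin (m + 1))) :
    IsNCJoin (finRotate (m + 1)) w (nextPerm (ncClosure w)) := by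
  have hA := adapted_nextPerm (ncClosure w)
  have hnc := nonCrossing_ncClosure w
  refine ⟨⟨⟨absLE_one _, hA.absLE hnc (adapted_finRotate m) le_top⟩, ?_⟩, ?_⟩
  · rintro t ⟨i, j, hij, rfl⟩ h
    rw [absLE_swap_iff hij] at h ⊢
    exact hA.sameCycle_iff.2 (rel_of_sameCycle (ncClosure_apply w) h)
  · rintro u ⟨⟨-, huc⟩, hu⟩
    obtain ⟨Q, hQ, hQu⟩ := (adapted_finRotate m).exists_of_absLE
      (fun _ _ _ _ _ _ _ _ _ => trivial) huc
    refine hA.absLE hnc hQu (ncClosure_le hQ fun i => ?_)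
    rcases eq_or_ne i (w i) with h | h
    · rw [← h]
    · exact hQu.sameCycle_iff.1 ((absLE_swap_iff h).1 (hu _ (swap_mem_reflections h)
        ((absLE_swap_iff h).2 (sameCycle_apply_right.2 (.refl _ _)))))

lemma ncProj_finRotate (m : ℕ) (w : Perm (Fin (m + 1))) :
    ncProj (finRotate (m + 1)) w = nextPerm (ncClosure w) := (isNCJoin_finRotate m w).ncProj_eq

/-! ### Equivariance under conjugation -/

lemma IsNCUpperBound.conj (g : Perm (Fin n)) {c w v : Perm (Fin n)} (h : IsNCUpperBound c w v) :
    IsNCUpperBound (g * c * g⁻¹) (g * w * g⁻¹) (g * v * g⁻¹) := by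
  refine ⟨⟨absLE_one _, (absLE_conj g).2 h.1.2⟩, ?_⟩
  rintro t ⟨i, j, hij, rfl⟩ ht
  have he : swap i j = g * swap (g⁻¹ i) (g⁻¹ j) * g⁻¹ := by
    rw [← swap_apply_apply]; simp
  rw [he, absLE_conj] at ht ⊢
  exact h.2 _ (swap_mem_reflections (g⁻¹.injective.ne hij)) ht

lemma IsNCJoin.conj (g : Perm (Fin n)) {c w v : Perm (Fin n)} (h : IsNCJoin c w v) :
    IsNCJoin (g * c * g⁻¹) (g * w * g⁻¹) (g * v * g⁻¹) := by
  refine ⟨h.1.conj g, fun u hu => ?_⟩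
  have h1 := hu.conj g⁻¹
  have he : ∀ x : Perm (Fin n), g⁻¹ * (g * x * g⁻¹) * g⁻¹⁻¹ = x := fun x => by group
  rw [he c, he w] at h1
  have h2 := (absLE_conj g).2 (h.2 _ h1)
  have h3 : g * (g⁻¹ * u * g⁻¹⁻¹) * g⁻¹ = u := by group
  rwa [h3] at h2

lemma popT_conj (m : ℕ) (g w : Perm (Fin (m + 1))) :
    popT (g * finRotate (m + 1) * g⁻¹) (g * w * g⁻¹) = g * popT (finRotate (m + 1)) w * g⁻¹ := by
  have h := isNCJoin_finRotate m w
  unfold popT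
  rw [h.ncProj_eq, (h.conj g).ncProj_eq]
  group

/-! ### Dynamics of the inverse permutation -/

/-- The operator on inverse permutations that corresponds to `popT`: the position `u j` of every
token `j` moves to the next element of its block in the noncrossing closure. -/
noncomputable def torse (u : Perm (Fin n)) : Perm (Fin n) := nextPerm (ncClosure u) * u

lemma torse_apply (u : Perm (Fin n)) (j : Fin n) : torse u j = nextPerm (ncClosure u) (u j) := rfl

lemma torse_iterate_succ_apply (u : Perm (Fin n)) (k : ℕ) (j : Fin n) :
    (torse^[k + 1] u) j
      = nextPerm (ncClosure (torse^[k] u)) ((torse^[k] u) j) := by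
  rw [Function.iterate_succ_apply', torse_apply]

lemma popT_eq_torse (w : Perm (Fin (m + 1))) : popT (finRotate (m + 1)) w = (torse w⁻¹)⁻¹ := by
  rw [popT, ncProj_finRotate, torse, ncClosure_inv]
  group

lemma popT_iterate_eq_torse (k : ℕ) (w : Perm (Fin (m + 1))) :
    (popT (finRotate (m + 1)))^[k] w = (torse^[k] w⁻¹)⁻¹ := by
  induction k with
  | zero => simp
  | succ k ih => rw [Function.iterate_succ_apply', Function.iterate_succ_apply', ih,
      popT_eq_torse, inv_inv]

lemma ncClosure_torse_le (u : Perm (Fin n)) : ncClosure (torse u) ≤ ncClosure u :=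
  ncClosure_le (nonCrossing_ncClosure u) fun i =>
    (ncClosure u).trans (ncClosure_apply u i) ((adapted_nextPerm _).rel _)

lemma ncClosure_torse_iterate_le (u : Perm (Fin n)) {k k' : ℕ} (h : k ≤ k') :
    ncClosure (torse^[k'] u) ≤ ncClosure (torse^[k] u) := by
  induction k', h using Nat.le_induction with
  | base => exact le_rfl
  | succ k' _ ih =>
    rw [Function.iterate_succ_apply']
    exact (ncClosure_torse_le _).trans ih

/-- An interval and its complement do not cross, so an interval invariant under `u` is a union of
blocks of the closure. -/
lemma mem_Icc_iff_of_ncClosure {u : Perm (Fin n)} {lo hi : Fin n}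
    (h : ∀ i, (lo ≤ i ∧ i ≤ hi) ↔ (lo ≤ u i ∧ u i ≤ hi)) {a b : Fin n} (hab : ncClosure u a b) :
    (lo ≤ a ∧ a ≤ hi) ↔ (lo ≤ b ∧ b ≤ hi) := by
  have h1 : ncClosure u ≤ Setoid.ker fun i => lo ≤ i ∧ i ≤ hi := by
    refine ncClosure_le (fun a b c d hab hbc hcd hac hbd => ?_) fun i => ?_
    · simp only [Setoid.ker_def, eq_iff_iff] at *
      constructor
      · intro h1
        have := hac.1 h1
        omega
      · intro h1
        have := hbd.1 h1
        have := hac.2 (by omega)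
        omega
    · simpa only [Setoid.ker_def, eq_iff_iff] using h i
  simpa only [Setoid.ker_def, eq_iff_iff] using h1 hab

lemma eq_of_ncClosure_of_fixed {u : Perm (Fin n)} {j : Fin n} (h : u j = j) {a : Fin n}
    (ha : ncClosure u j a) : a = j := by
  have := (mem_Icc_iff_of_ncClosure (lo := j) (hi := j) (fun i => ?_) ha).1 (by simp)
  · exact le_antisymm this.2 this.1
  · have e : ∀ x : Fin n, (j ≤ x ∧ x ≤ j) ↔ x = j := fun x => by omega
    rw [e, e]
    exact ⟨fun e => by rw [e, h], fun e => u.injective (e.trans h.symm)⟩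

lemma torse_apply_of_fixed {u : Perm (Fin n)} {j : Fin n} (h : u j = j) : torse u j = j := by
  rw [torse_apply, h]
  exact eq_of_ncClosure_of_fixed h ((adapted_nextPerm _).rel j)

lemma ncClosure_iterate_last (u : Perm (Fin (m + 1))) {k k' : ℕ} (h : k ≤ k') :
    ncClosure (torse^[k] u) (Fin.last m) ((torse^[k'] u) (Fin.last m)) :=
  ncClosure_torse_iterate_le u h (ncClosure_apply _ _)

lemma lt_nextPerm_of_rel_last {R : Setoid (Fin (m + 1))} {p : Fin (m + 1)}
    (h : R (Fin.last m) p) (hp : p < Fin.last m) : p < nextPerm R p :=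
  ((adapted_nextPerm R).step p _ (R.symm h) hp).1

lemma torse_iterate_last_lt (u : Perm (Fin (m + 1))) {k : ℕ}
    (h : (torse^[k] u) (Fin.last m) < Fin.last m) :
    (torse^[k] u) (Fin.last m) < (torse^[k + 1] u) (Fin.last m) := by
  rw [torse_iterate_succ_apply]
  exact lt_nextPerm_of_rel_last (ncClosure_apply _ _) h

lemma torse_iterate_eq_of_fixed (u : Perm (Fin n)) {k k' : ℕ} (hk : k ≤ k') {j : Fin n}
    (h : (torse^[k] u) j = j) : (torse^[k'] u) j = j := by
  induction k', hk using Nat.le_induction with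
  | base => exact h
  | succ k' _ ih =>
    rw [Function.iterate_succ_apply']
    exact torse_apply_of_fixed ih

lemma torse_iterate_last_lt_of_lt (u : Perm (Fin (m + 1))) {k k' : ℕ} (hk : k < k')
    (h : (torse^[k] u) (Fin.last m) < Fin.last m) :
    (torse^[k] u) (Fin.last m) < (torse^[k'] u) (Fin.last m) := by
  induction k', hk using Nat.le_induction with
  | base => exact torse_iterate_last_lt u h
  | succ k' _ ih =>
    rcases (Fin.le_last ((torse^[k'] u) (Fin.last m))).lt_or_eq with h1 | h1
    · exact ih.trans (torse_iterate_last_lt u h1)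
    · rw [torse_iterate_eq_of_fixed u (Nat.le_succ k') h1]
      exact h

lemma torse_iterate_last_eq_or_le (u : Perm (Fin (m + 1))) (k : ℕ) :
    (torse^[k] u) (Fin.last m) = Fin.last m ∨
      k + (u (Fin.last m) : ℕ) ≤ (torse^[k] u) (Fin.last m) := by
  induction k with
  | zero => right; simp
  | succ k ih =>
    by_cases h : (torse^[k] u) (Fin.last m) = Fin.last m
    · exact .inl (torse_iterate_eq_of_fixed u (Nat.le_succ k) h)
    · have h1 := torse_iterate_last_lt u (lt_of_le_of_ne (Fin.le_last _) h)
      rcases ih with h2 | h2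
      · exact absurd h2 h
      · right; omega

/-- After `m` steps the last token has come home. -/
lemma torse_iterate_m_last (u : Perm (Fin (m + 1))) : (torse^[m] u) (Fin.last m) = Fin.last m := by
  rcases torse_iterate_last_eq_or_le u m with h | h
  · exact h
  · refine Fin.ext (le_antisymm (Fin.le_last _) ?_)
    simp only [Fin.val_last]
    omega

/-! ### Rotation -/

/-- Conjugation by `c` fixes `c`, so the dynamics is rotation invariant although its description
uses the linear order. -/
lemma torse_conj_finRotate (u : Perm (Fin (m + 1))) :
    torse (finRotate (m + 1) * u * (finRotate (m + 1))⁻¹)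
      = finRotate (m + 1) * torse u * (finRotate (m + 1))⁻¹ := by
  have h := popT_conj m (finRotate (m + 1)) u⁻¹
  rw [mul_inv_cancel_right, popT_eq_torse, popT_eq_torse] at h
  have h1 : (finRotate (m + 1) * u⁻¹ * (finRotate (m + 1))⁻¹)⁻¹
      = finRotate (m + 1) * u * (finRotate (m + 1))⁻¹ := by group
  rw [h1, inv_inv, inv_eq_iff_eq_inv] at h
  rw [h]
  group

lemma torse_iterate_conj (k r : ℕ) (u : Perm (Fin (m + 1))) :
    torse^[k] (finRotate (m + 1) ^ r * u * (finRotate (m + 1) ^ r)⁻¹)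
      = finRotate (m + 1) ^ r * torse^[k] u * (finRotate (m + 1) ^ r)⁻¹ := by
  have h1 : ∀ (r : ℕ) (u : Perm (Fin (m + 1))),
      torse (finRotate (m + 1) ^ r * u * (finRotate (m + 1) ^ r)⁻¹)
        = finRotate (m + 1) ^ r * torse u * (finRotate (m + 1) ^ r)⁻¹ := by
    intro r
    induction r with
    | zero => simp
    | succ r ih =>
      intro u
      have h2 : ∀ x : Perm (Fin (m + 1)),
          finRotate (m + 1) ^ (r + 1) * x * (finRotate (m + 1) ^ (r + 1))⁻¹
          = finRotate (m + 1) * (finRotate (m + 1) ^ r * x * (finRotate (m + 1) ^ r)⁻¹)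
            * (finRotate (m + 1))⁻¹ := fun x => by
        rw [pow_succ']; group
      rw [h2, torse_conj_finRotate, ih, h2]
  induction k with
  | zero => rfl
  | succ k ih => rw [Function.iterate_succ_apply', ih, h1, Function.iterate_succ_apply']

lemma exists_finRotate_pow (v : Fin (m + 1)) : ∃ r : ℕ, (finRotate (m + 1) ^ r) v = Fin.last m := by
  have h := ((adapted_finRotate m).sameCycle_iff (a := v) (b := Fin.last m)).2 trivial
  exact h.exists_nat_pow_eq

lemma torse_iterate_m (u : Perm (Fin (m + 1))) : torse^[m] u = 1 := by
  ext v
  obtain ⟨r, hr⟩ := exists_finRotate_pow v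
  have h := torse_iterate_m_last (finRotate (m + 1) ^ r * u * (finRotate (m + 1) ^ r)⁻¹)
  have hr' : (finRotate (m + 1) ^ r)⁻¹ (Fin.last m) = v := by rw [← hr]; simp
  rw [torse_iterate_conj, Perm.mul_apply, Perm.mul_apply, hr', ← hr] at h
  rw [(finRotate (m + 1) ^ r).injective h]
  rfl

lemma exists_conj_last_ne {u : Perm (Fin (m + 1))} {k : ℕ} (h : torse^[k] u ≠ 1) :
    ∃ r : ℕ, (torse^[k] (finRotate (m + 1) ^ r * u * (finRotate (m + 1) ^ r)⁻¹)) (Fin.last m)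
      ≠ Fin.last m := by
  obtain ⟨v, hv⟩ : ∃ v, (torse^[k] u) v ≠ v := by
    by_contra! h'
    exact h (Equiv.ext h')
  obtain ⟨r, hr⟩ := exists_finRotate_pow v
  refine ⟨r, fun h' => hv ?_⟩
  have hr' : (finRotate (m + 1) ^ r)⁻¹ (Fin.last m) = v := by rw [← hr]; simp
  rw [torse_iterate_conj, Perm.mul_apply, Perm.mul_apply, hr', ← hr] at h'
  exact (finRotate (m + 1) ^ r).injective h'

/-! ### Increasing cycles -/

/-- The partition with block `S` and all other blocks singletons. -/
def blockSetoid (S : Finset (Fin n)) : Setoid (Fin n) where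
  r a b := a = b ∨ (a ∈ S ∧ b ∈ S)
  iseqv := ⟨fun _ => .inl rfl, fun h => h.imp Eq.symm And.symm, fun {a b c} h h' => by
    rcases h with rfl | h
    · exact h'
    rcases h' with rfl | h'
    exacts [.inr h, .inr ⟨h.1, h'.2⟩]⟩

/-- The increasing cycle on the elements of `S`. -/
noncomputable def incCycle (S : Finset (Fin n)) : Perm (Fin n) := nextPerm (blockSetoid S)

lemma adapted_incCycle (S : Finset (Fin n)) : Adapted (blockSetoid S) (incCycle S) :=
  adapted_nextPerm _

lemma incCycle_of_notMem {S : Finset (Fin n)} {a : Fin n} (h : a ∉ S) : incCycle S a = a := by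
  rcases (adapted_incCycle S).rel a with h1 | h1
  exacts [h1.symm, absurd h1.1 h]

lemma incCycle_mem {S : Finset (Fin n)} {a : Fin n} (h : a ∈ S) : incCycle S a ∈ S := by
  rcases (adapted_incCycle S).rel a with h1 | h1
  exacts [h1 ▸ h, h1.2]

lemma incCycle_lt {S : Finset (Fin n)} {a b : Fin n} (ha : a ∈ S) (hb : b ∈ S) (hab : a < b) :
    a < incCycle S a ∧ incCycle S a ≤ b :=
  (adapted_incCycle S).step a b (.inr ⟨ha, hb⟩) hab

lemma incCycle_le_of_max {S : Finset (Fin n)} {a b : Fin n} (ha : a ∈ S) (hmax : ∀ y ∈ S, y ≤ a)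
    (hb : b ∈ S) : incCycle S a ≤ b :=
  (adapted_incCycle S).apply_le (hmax _ (incCycle_mem ha)) (.inr ⟨ha, hb⟩)

/-- A permutation with at most one descent `z j < j` is an increasing cycle. -/
lemma eq_incCycle_support {z : Perm (Fin n)} {x : Fin n} (h : ∀ j, j ≠ x → j ≤ z j) :
    z = incCycle z.support := by
  classical
  have hlt : ∀ j ∈ z.support, j ≠ x → j < z j := fun j hj hx =>
    lt_of_le_of_ne (h j hx) (mem_support.1 hj).symm
  have hmax : ∀ b ∈ z.support, b ≤ x := by
    intro b hb
    obtain ⟨y, hy, hy'⟩ := Set.exists_max_image (z.support : Set (Fin n)) id (Set.toFinite _) ⟨b, hb⟩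
    have hyx : y = x := by
      by_contra hne
      exact absurd (hy' (z y) (apply_mem_support.2 hy)) (not_le.2 (hlt y hy hne))
    exact hyx ▸ hy' b hb
  refine Adapted.eq_nextPerm ⟨fun a => ?_, fun a b hab hlt' => ?_⟩
  · by_cases ha : a ∈ z.support
    · exact .inr ⟨ha, apply_mem_support.2 ha⟩
    · exact .inl (notMem_support.1 ha).symm
  · rcases hab with rfl | ⟨ha, hb⟩
    · exact absurd hlt' (lt_irrefl _)
    have hax : a ≠ x := fun e => absurd (hmax b hb) (not_le.2 (e ▸ hlt'))
    refine ⟨hlt a ha hax, ?_⟩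
    by_contra! hba
    -- If `z` jumped from `a` over `b`, it would send `a` and all of `A` except `x` injectively into
    -- `A` without `b`, which is too small.
    let A := z.support.filter (b ≤ ·)
    have hA : ∀ y ∈ insert a (A.erase x), z y ∈ A.erase b := by
      intro y hy
      simp only [A, Finset.mem_insert, Finset.mem_erase, Finset.mem_filter] at hy ⊢
      rcases hy with rfl | ⟨hyx, hys, hby⟩
      · exact ⟨hba.ne', apply_mem_support.2 ha, hba.le⟩
      · have := hlt y hys hyx
        exact ⟨by omega, apply_mem_support.2 hys, by omega⟩
    have h1 := Finset.card_le_card_of_injOn z hA z.injective.injOn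
    have hbA : b ∈ A := by simp only [A, Finset.mem_filter]; exact ⟨hb, le_rfl⟩
    have haA : a ∉ A.erase x := by
      simp only [A, Finset.mem_erase, Finset.mem_filter]
      rintro ⟨-, -, h2⟩
      omega
    rw [Finset.card_insert_of_notMem haA, Finset.card_erase_of_mem hbA] at h1
    have h2 := Finset.pred_card_le_card_erase (s := A) (a := x)
    have h3 := Finset.card_pos.2 ⟨b, hbA⟩
    omega

/-! ### Tokens that are slow to come home -/

/-- The subsets `S` for which `c` times the increasing cycle on `S` is slow. -/
def IsSlowSet (S : Finset (Fin (m + 1))) : Prop :=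
  S.card ≠ 1 ∧ (S.card = 2 → ∃ a ∈ S, finRotate (m + 1) a ∈ S)

lemma exists_missed {q : ℕ → Fin (m + 1)} (hm : 2 ≤ m)
    (hlt : ∀ k ≤ m - 2, q k < Fin.last m) (hinj : ∀ k k', k < k' → k' ≤ m - 2 → q k < q k') :
    ∃ x, x ≠ Fin.last m ∧
      ∀ y, y ≠ x → y = Fin.last m ∨ ∃ k ≤ m - 2, q k = y := by
  classical
  let T : Finset (Fin (m + 1)) := insert (Fin.last m) ((Finset.range (m - 1)).image q)
  have h1 : T.card = m := by
    rw [Finset.card_insert_of_notMem, Finset.card_image_of_injOn, Finset.card_range]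
    · omega
    · intro k hk k' hk' he
      simp only [Finset.coe_range, Set.mem_Iio] at hk hk'
      rcases lt_trichotomy k k' with h | h | h
      · exact absurd he (hinj k k' h (by omega)).ne
      · exact h
      · exact absurd he (hinj k' k h (by omega)).ne'
    · simp only [Finset.mem_image, Finset.mem_range, not_exists, not_and]
      exact fun k hk => (hlt k (by omega)).ne
  have h2 : Tᶜ.card = 1 := by rw [Finset.card_compl, h1]; simp
  obtain ⟨x, hx⟩ := Finset.card_eq_one.1 h2
  have hT : ∀ y, y ∉ T ↔ y = x := fun y => by
    rw [← Finset.mem_compl, hx, Finset.mem_singleton]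
  have hxT : x ∉ T := (hT x).2 rfl
  refine ⟨x, fun e => hxT (by simp [T, e]), fun y hy => ?_⟩
  · have : y ∈ T := not_not.1 fun h => hy ((hT y).1 h)
    rcases Finset.mem_insert.1 this with h | h
    · exact .inl h
    · obtain ⟨k, hk, e⟩ := Finset.mem_image.1 h
      exact .inr ⟨k, by simp at hk; omega, e⟩

/-- Tokens ahead of the last one, away from the single skipped position, have to pass it. -/
lemma lt_apply_of_slow {u : Perm (Fin (m + 1))} {x j : Fin (m + 1)}
    (hB : ∀ k y, (torse^[k] u) (Fin.last m) ≤ y → y ≠ x →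
      ncClosure (torse^[k] u) (Fin.last m) y)
    (hjx : j ≠ x) (hj : j < Fin.last m) (hq : u (Fin.last m) < u j) : j < u j := by
  by_contra! hle
  -- Both tokens share a block with the position `j`: the last one moves at most to where token `j`
  -- stood, and token `j` moves strictly ahead, but not beyond `j`.
  have key : ∀ k, (torse^[k] u) (Fin.last m) < (torse^[k] u) j ∧ (torse^[k] u) j ≤ j := by
    intro k
    induction k with
    | zero => exact ⟨hq, hle⟩
    | succ k ih =>
      obtain ⟨h1, h2⟩ := ih
      have hA := adapted_nextPerm (ncClosure (torse^[k] u))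
      have hjB := hB k j (by omega) hjx
      have hpj := ncClosure_apply (torse^[k] u) j
      have hne : (torse^[k] u) j ≠ j := fun e =>
        hj.ne' (eq_of_ncClosure_of_fixed e ((ncClosure _).symm hjB))
      have hpB := (ncClosure (torse^[k] u)).trans hjB hpj
      rw [torse_iterate_succ_apply, torse_iterate_succ_apply]
      have h3 := hA.step _ _
        ((ncClosure _).trans ((ncClosure _).symm (ncClosure_apply _ (Fin.last m))) hpB) h1
      have h4 := hA.step _ _ ((ncClosure _).symm hpj) (lt_of_le_of_ne h2 hne)
      exact ⟨h3.2.trans_lt h4.1, h4.2⟩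
  have h := key m
  rw [torse_iterate_m_last] at h
  exact absurd h.1 (not_lt.2 (Fin.le_last _))

lemma finRotate_inv_val {y : Fin (m + 1)} (hy : y ≠ 0) :
    (((finRotate (m + 1))⁻¹ y : Fin (m + 1)) : ℕ) + 1 = y := by
  have h := coe_finRotate_symm_of_ne_zero hy
  have : (y : ℕ) ≠ 0 := fun e => hy (Fin.ext e)
  rw [← Equiv.Perm.inv_def] at h
  omega

lemma finRotate_inv_zero : (finRotate (m + 1))⁻¹ 0 = Fin.last m := by
  rw [Perm.inv_eq_iff_eq, finRotate_last]

lemma finRotate_val {y : Fin (m + 1)} (hy : y < Fin.last m) :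
    ((finRotate (m + 1) y : Fin (m + 1)) : ℕ) = y + 1 := coe_finRotate_of_ne_last hy.ne

lemma exists_isSlowSet_of_last_ne (hm : 2 ≤ m) {u : Perm (Fin (m + 1))}
    (h : (torse^[m - 2] u) (Fin.last m) ≠ Fin.last m) :
    ∃ S, IsSlowSet S ∧ u = finRotate (m + 1) * incCycle S := by
  classical
  have hlt : ∀ k ≤ m - 2, (torse^[k] u) (Fin.last m) < Fin.last m := fun k hk =>
    lt_of_le_of_ne (Fin.le_last _) fun e => h (torse_iterate_eq_of_fixed u hk e)
  obtain ⟨x, hxl, hx⟩ := exists_missed (q := fun k => (torse^[k] u) (Fin.last m)) hm hlt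
    fun k k' hk hk' => torse_iterate_last_lt_of_lt u hk (hlt k (by omega))
  have hB : ∀ k y, (torse^[k] u) (Fin.last m) ≤ y → y ≠ x →
      ncClosure (torse^[k] u) (Fin.last m) y := by
    intro k y hy hyx
    rcases hx y hyx with rfl | ⟨k', hk', rfl⟩
    · exact (ncClosure _).refl _
    · refine ncClosure_iterate_last u ?_
      by_contra! hlt'
      exact absurd (torse_iterate_last_lt_of_lt u hlt' (hlt k' hk')) (not_lt.2 hy)
  have hj : ∀ j, j ≠ x → j < Fin.last m → u (Fin.last m) < u j → j < u j :=
    fun j hjx hjl hq => lt_apply_of_slow hB hjx hjl hq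
  -- There is only one missed position, so the start is `0` or `1`; in the second case the missed
  -- position is `0`.
  have hq0 : (u (Fin.last m) : ℕ) ≤ 1 := by
    rcases torse_iterate_last_eq_or_le u (m - 2) with h1 | h1
    · exact absurd h1 h
    · have h2 := hlt (m - 2) le_rfl
      rw [Fin.lt_def, Fin.val_last] at h2
      omega
  set z := (finRotate (m + 1))⁻¹ * u with hz
  have huz : u = finRotate (m + 1) * z := by rw [hz, mul_inv_cancel_left]
  have hzval : ∀ j, u j ≠ 0 → (z j : ℕ) + 1 = u j := fun j => finRotate_inv_val
  have hz0 : ∀ j, u j = 0 → z j = Fin.last m := fun j hj0 => by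
    rw [hz, Perm.mul_apply, hj0, finRotate_inv_zero]
  by_cases h0 : u (Fin.last m) = 0
  · have hzj : ∀ j, j ≠ x → j ≤ z j := by
      intro j hjx
      rcases (Fin.le_last j).lt_or_eq with hjl | rfl
      · have hne : u j ≠ 0 := fun e => hjl.ne (u.injective (e.trans h0.symm))
        have h1 := hj j hjx hjl (by rw [h0]; exact Fin.pos_iff_ne_zero.2 hne)
        have h2 := hzval j hne
        omega
      · rw [hz0 _ h0]
    have hzS := eq_incCycle_support hzj
    refine ⟨z.support, ⟨card_support_ne_one z, fun h2 => ?_⟩, by rw [← hzS, huz]⟩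
    obtain ⟨a, b, hab, hzab⟩ : ∃ a b, a < b ∧ z = swap a b := by
      obtain ⟨a, b, hab, hs⟩ := card_support_eq_two.1 h2
      rcases lt_or_gt_of_ne hab with h1 | h1
      exacts [⟨a, b, h1, hs⟩, ⟨b, a, h1, by rw [hs, swap_comm]⟩]
    have hsupp : ∀ y, y ∈ z.support ↔ y = a ∨ y = b := fun y => by
      rw [hzab, support_swap hab.ne]; simp
    have hbl : b < Fin.last m := by
      refine lt_of_le_of_ne (Fin.le_last _) fun e => ?_
      have h1 := hz0 _ h0
      rw [← e, hzab, swap_apply_right] at h1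
      exact hab.ne h1
    have hca := finRotate_val (hab.trans hbl)
    refine ⟨a, (hsupp a).2 (.inl rfl), (hsupp _).2 (.inr ?_)⟩
    by_contra hne
    have hne' : (a : ℕ) + 1 ≠ b := fun e => hne (Fin.ext (by omega))
    have hua : u a = finRotate (m + 1) b := by rw [huz, hzab]; simp
    have hub : u b = finRotate (m + 1) a := by rw [huz, hzab]; simp
    have huy : ∀ y, y ≠ a → y ≠ b → u y = finRotate (m + 1) y := fun y h1 h2 => by
      rw [huz, hzab, Perm.mul_apply, swap_apply_of_ne_of_ne h1 h2]
    have hcb := finRotate_val hbl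
    -- For a nonadjacent pair `a < b`, the interval from `a + 1` to `b` is invariant under `u`. Its
    -- two distinct ends are outside the block of the last token, so both would have to be `x`.
    have hinv : ∀ i, (finRotate (m + 1) a ≤ i ∧ i ≤ b)
        ↔ (finRotate (m + 1) a ≤ u i ∧ u i ≤ b) := by
      intro i
      rcases eq_or_ne i a with rfl | hia
      · rw [hua]; omega
      rcases eq_or_ne i b with rfl | hib
      · rw [hub]; omega
      rw [huy i hia hib]
      rcases (Fin.le_last i).lt_or_eq with hil | rfl
      · have := finRotate_val hil
        omega
      · have : ((finRotate (m + 1) (Fin.last m) : Fin (m + 1)) : ℕ) = 0 := by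
          rw [finRotate_last]; rfl
        omega
    have hout : ∀ y, ncClosure u (Fin.last m) y → ¬ (finRotate (m + 1) a ≤ y ∧ y ≤ b) := by
      intro y hy h1
      have := (mem_Icc_iff_of_ncClosure hinv hy).2 h1
      omega
    have hmem : ∀ y, y ≠ x → ncClosure u (Fin.last m) y := fun y hy =>
      hB 0 y (by rw [Function.iterate_zero, id, h0]; exact Fin.zero_le _) hy
    have e1 : finRotate (m + 1) a = x := not_not.1 fun e => hout _ (hmem _ e) (by omega)
    have e2 : b = x := not_not.1 fun e => hout _ (hmem _ e) (by omega)
    exact hne (e1.trans e2.symm)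
  · have h1 : (u (Fin.last m) : ℕ) = 1 := by
      have : (u (Fin.last m) : ℕ) ≠ 0 := fun e => h0 (Fin.ext e)
      omega
    have hx0 : x = 0 := by
      by_contra hne
      rcases hx 0 (Ne.symm hne) with h2 | ⟨k, hk, h2⟩
      · have := congrArg Fin.val h2
        simp only [Fin.val_zero, Fin.val_last] at this
        omega
      · rcases torse_iterate_last_eq_or_le u k with h3 | h3
        · exact (hlt k hk).ne h3
        · rw [h2, h1] at h3
          simp at h3
    have hzl : z (Fin.last m) = 0 := Fin.ext (by have := hzval _ h0; simp only [Fin.val_zero]; omega)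
    have hzj : ∀ j, j ≠ Fin.last m → j ≤ z j := by
      intro j hjl
      by_cases hjx : j = x
      · rw [hjx, hx0]; exact Fin.zero_le _
      by_cases hne : u j = 0
      · rw [hz0 j hne]; exact Fin.le_last _
      · have h2 := hzval j hne
        have h3 : u j ≠ u (Fin.last m) := u.injective.ne hjl
        have h4 : (u j : ℕ) ≠ u (Fin.last m) := fun e => h3 (Fin.ext e)
        have h5 : (u j : ℕ) ≠ 0 := fun e => hne (Fin.ext e)
        have h6 := hj j hjx (lt_of_le_of_ne (Fin.le_last _) hjl) (by omega)
        omega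
    have hzS := eq_incCycle_support hzj
    have hl : Fin.last m ∈ z.support := by
      rw [mem_support, hzl]
      exact fun e => hxl (hx0.trans e)
    refine ⟨z.support, ⟨card_support_ne_one z, fun _ => ⟨Fin.last m, hl, ?_⟩⟩, by rw [← hzS, huz]⟩
    rw [finRotate_last, ← hzl]
    exact apply_mem_support.2 hl

/-! ### Tokens that stay ahead of the last one -/

lemma gap_apply {u : Perm (Fin n)} {b y : Fin n} (h : b < y)
    (h' : y < nextPerm (ncClosure u) b) : b < u y ∧ u y < nextPerm (ncClosure u) b :=
  (adapted_nextPerm _).mem_gap (nonCrossing_ncClosure u) h h' (ncClosure_apply u y)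

lemma gap_of_apply {u : Perm (Fin n)} {b y : Fin n} (h : b < u y)
    (h' : u y < nextPerm (ncClosure u) b) : b < y ∧ y < nextPerm (ncClosure u) b :=
  (adapted_nextPerm _).mem_gap (nonCrossing_ncClosure u) h h'
    ((ncClosure u).symm (ncClosure_apply u y))

section Gap

variable {u : Perm (Fin (m + 1))} {X : Fin (m + 1) → Prop}
  (hgap : ∀ b, u (Fin.last m) ≤ b → b < Fin.last m →
    ∀ y, b < y → y < nextPerm (ncClosure u) b → X y)
include hgap

/-- `X` marks the positions that may be skipped. If `y` were not in the block, it would lie in the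
gap after the largest block element below it. -/
lemma rel_last_of_gap {y : Fin (m + 1)} (hy : u (Fin.last m) ≤ y) (hX : ¬ X y) :
    ncClosure u (Fin.last m) y := by
  obtain ⟨b, ⟨hb1, hb2, hb3⟩, hmax⟩ := Set.exists_max_image
    {b | ncClosure u (Fin.last m) b ∧ u (Fin.last m) ≤ b ∧ b ≤ y} id (Set.toFinite _)
    ⟨_, ncClosure_apply _ _, le_rfl, hy⟩
  rcases hb3.eq_or_lt with rfl | hlt
  · exact hb1
  have hbl : b < Fin.last m := hlt.trans_le (Fin.le_last y)
  have h1 := lt_nextPerm_of_rel_last hb1 hbl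
  have h2 := (ncClosure u).trans hb1 ((adapted_nextPerm (ncClosure u)).rel b)
  rcases le_or_gt (nextPerm (ncClosure u) b) y with h3 | h3
  · exact absurd (hmax _ ⟨h2, hb2.trans h1.le, h3⟩) (not_le.2 h1)
  · exact absurd (hgap b hb2 hbl y hlt h3) hX

lemma lt_nextPerm_of_gap {p : Fin (m + 1)} (hp : u (Fin.last m) ≤ p) (hpl : p < Fin.last m)
    (hX : ¬ X p) : p < nextPerm (ncClosure u) p :=
  lt_nextPerm_of_rel_last (rel_last_of_gap hgap hp hX) hpl

/-- Tokens behind the last one do not overtake it: a jump beyond `u (Fin.last m)` would end in its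
block and pass over an element of that block, or end at a fixed position, which is a singleton
block. -/
lemma nextPerm_le_of_gap (hXs : ∀ y, X y → u y = y) {p : Fin (m + 1)}
    (hp : p = Fin.last m ∨ p < u (Fin.last m)) :
    nextPerm (ncClosure u) p ≤ u (Fin.last m) := by
  have hA := adapted_nextPerm (ncClosure u)
  rcases hp with rfl | hp
  · exact hA.apply_le (Fin.le_last _) (ncClosure_apply _ _)
  by_contra! hlt
  by_cases hX : X (nextPerm (ncClosure u) p)
  · have := eq_of_ncClosure_of_fixed (hXs _ hX) ((ncClosure u).symm (hA.rel p))
    omega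
  · have h1 := rel_last_of_gap hgap hlt.le hX
    have h2 := (ncClosure u).trans (ncClosure u |>.trans (hA.rel p) ((ncClosure u).symm h1))
      (ncClosure_apply u (Fin.last m))
    exact absurd (hA.step p _ h2 hp).2 (not_le.2 hlt)

end Gap

lemma nextPerm_val_of_gap {u : Perm (Fin (m + 1))}
    (hgap : ∀ b, u (Fin.last m) ≤ b → b < Fin.last m →
      ∀ y, b < y → y < nextPerm (ncClosure u) b → False)
    {p : Fin (m + 1)} (hp : u (Fin.last m) ≤ p) (hpl : p < Fin.last m) :
    (nextPerm (ncClosure u) p : ℕ) = p + 1 := by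
  have h1 := lt_nextPerm_of_gap hgap hp hpl not_false
  by_contra hne
  have h2 : (p : ℕ) + 1 < nextPerm (ncClosure u) p := by
    rw [Fin.lt_def] at h1; omega
  exact hgap p hp hpl ⟨p + 1, by omega⟩ (by rw [Fin.lt_def]; simp) (by rw [Fin.lt_def]; exact h2)

/-- If no token ahead of the last one is about to come home, the last token never skips. -/
lemma torse_iterate_last_ne_of_lt (hm : 2 ≤ m) {u : Perm (Fin (m + 1))}
    (hq : (u (Fin.last m) : ℕ) ≤ 1)
    (h : ∀ j, u (Fin.last m) ≤ j → j < Fin.last m → j < u j ∨ u j < u (Fin.last m)) :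
    (torse^[m - 2] u) (Fin.last m) ≠ Fin.last m := by
  have key : ∀ k, k + (u (Fin.last m) : ℕ) ≤ m →
      ((torse^[k] u) (Fin.last m) : ℕ) = k + u (Fin.last m) ∧
      ∀ j, u (Fin.last m) ≤ j → j < Fin.last m →
        j < (torse^[k] u) j ∨ (torse^[k] u) j < (torse^[k] u) (Fin.last m) := by
    intro k
    induction k with
    | zero => exact fun _ => ⟨by simp, h⟩
    | succ k ih =>
      intro hk
      obtain ⟨h1, h2⟩ := ih (by omega)
      rw [Function.iterate_succ_apply']
      set v := torse^[k] u
      have hgap : ∀ b, v (Fin.last m) ≤ b → b < Fin.last m →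
          ∀ y, b < y → y < nextPerm (ncClosure v) b → False := by
        intro b hb hbl y hy hy'
        rw [Fin.lt_def] at hy hy'
        -- The token whose home is the last position of the gap sits in the gap, so it is ahead of
        -- the last token without having passed its home.
        have hy2 : ((nextPerm (ncClosure v) b : Fin (m + 1)) : ℕ) - 1 < m + 1 := by omega
        have h3 := gap_apply (u := v) (b := b)
          (y := ⟨(nextPerm (ncClosure v) b : Fin (m + 1)) - 1, hy2⟩)
          (by rw [Fin.lt_def]; simp only; omega) (by rw [Fin.lt_def]; simp only; omega)
        have h4 := h2 ⟨(nextPerm (ncClosure v) b : Fin (m + 1)) - 1, hy2⟩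
          (by rw [Fin.le_def]; simp only; omega) (by rw [Fin.lt_def]; simp only [Fin.val_last]; omega)
        simp only [Fin.lt_def] at h3 h4
        omega
      have hvl : v (Fin.last m) < Fin.last m := by rw [Fin.lt_def, h1, Fin.val_last]; omega
      have h3 := nextPerm_val_of_gap hgap le_rfl hvl
      refine ⟨by rw [torse_apply, h3]; omega, fun j hj hjl => ?_⟩
      rw [torse_apply, torse_apply]
      have hne : v j ≠ v (Fin.last m) := v.injective.ne hjl.ne
      by_cases hc : v j = Fin.last m ∨ v j < v (Fin.last m)
      · right
        have := nextPerm_le_of_gap hgap (fun _ h => h.elim) hc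
        omega
      · push Not at hc
        have h4 := nextPerm_val_of_gap hgap hc.2 (lt_of_le_of_ne (Fin.le_last _) hc.1)
        left
        rcases h2 j hj hjl with h5 | h5 <;> omega
  have h1 := (key (m - 2) (by omega)).1
  intro e
  rw [e, Fin.val_last] at h1
  omega

/-- The stage at which the token `x` still moves towards its home. -/
def EarlyStage (v : Perm (Fin (m + 1))) (a x : Fin (m + 1)) (k : ℕ) : Prop :=
  (v (Fin.last m) : ℕ) = k ∧ (v x : ℕ) = a + 1 + k ∧ v x ≤ x ∧
    ∀ j, j ≠ x → j < Fin.last m → (j : ℕ) + 1 + k ≤ v j ∨ (v j : ℕ) < k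

/-- The stage at which the token `x` is home. -/
def LateStage (v : Perm (Fin (m + 1))) (x : Fin (m + 1)) (k : ℕ) : Prop :=
  v x = x ∧ (v (Fin.last m) : ℕ) ≤ k + 1 ∧ (v (Fin.last m) < x → (v (Fin.last m) : ℕ) ≤ k) ∧
    ∀ j, j ≠ x → j < Fin.last m → j < v j ∨ v j < v (Fin.last m)

/-- Without gaps every token ahead advances by exactly one. In a nonempty gap, only token `x` can
have its home at the right end or sit at the left end, so the gap runs from `v x` to `x`. -/
lemma EarlyStage.torse {v : Perm (Fin (m + 1))} {a x : Fin (m + 1)} {k : ℕ}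
    (h : EarlyStage v a x k) (hx : x < Fin.last m) (hlt : v x < x) (h0 : k = 0 → v a ≤ x) :
    EarlyStage (torse v) a x (k + 1) := by
  obtain ⟨h1, h2, h3, h4⟩ := h
  have hgap : ∀ b, v (Fin.last m) ≤ b → b < Fin.last m →
      ∀ y, b < y → y < nextPerm (ncClosure v) b → False := by
    intro b hb hbl y hy hy'
    set b' := nextPerm (ncClosure v) b
    have hG : ∀ y, b < y → y < b' → b < v y ∧ v y < b' := fun y => gap_apply
    have hG' : ∀ y, b < v y → v y < b' → b < y ∧ y < b' := fun y => gap_of_apply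
    -- the last element of the gap is `x`
    obtain ⟨t, ht⟩ : ∃ t : Fin (m + 1), (t : ℕ) + 1 = b' :=
      ⟨⟨b' - 1, by omega⟩, by simp only; omega⟩
    have ht1 := hG t (by omega) (by omega)
    have htx : t = x := by
      by_contra hne
      have := h4 t hne (by rw [Fin.lt_def, Fin.val_last]; omega)
      omega
    -- the first element of the gap is the position of `x`
    obtain ⟨s, hs⟩ : ∃ s : Fin (m + 1), (v s : ℕ) = b + 1 :=
      ⟨v.symm ⟨b + 1, by omega⟩, by simp⟩
    have hs1 := hG' s (by omega) (by omega)
    have hsx : s = x := by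
      by_contra hne
      have := h4 s hne (by rw [Fin.lt_def, Fin.val_last]; omega)
      omega
    subst htx
    subst hsx
    -- For `k = 0` the position of token `a` lies in the gap but its home does not; for `k > 0`
    -- token `x - 1` has its home in the gap but its position outside.
    rcases Nat.eq_zero_or_pos k with hk | hk
    · have hba : b = a := Fin.ext (by omega)
      have h5 := h0 hk
      have h6 := h4 a (by omega) (by omega)
      have := hG' a (by omega) (by omega)
      omega
    · obtain ⟨r, hr⟩ : ∃ r : Fin (m + 1), (r : ℕ) + 1 = s :=
        ⟨⟨s - 1, by omega⟩, by simp only; omega⟩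
      have h5 := hG r (by omega) (by omega)
      have := h4 r (by omega) (by omega)
      omega
  have hvl : v (Fin.last m) < Fin.last m := by
    rw [Fin.lt_def, Fin.val_last] at *; omega
  have hl := nextPerm_val_of_gap hgap le_rfl hvl
  have hxx := nextPerm_val_of_gap hgap (p := v x) (by omega) (by omega)
  refine ⟨by rw [torse_apply]; omega, by rw [torse_apply]; omega, by rw [torse_apply]; omega,
    fun j hjx hjl => ?_⟩
  rw [torse_apply]
  have hne : v j ≠ v (Fin.last m) := v.injective.ne hjl.ne
  by_cases hc : v j = Fin.last m ∨ v j < v (Fin.last m)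
  · right
    have := nextPerm_le_of_gap hgap (fun _ h => h.elim) hc
    omega
  · push Not at hc
    have h5 := nextPerm_val_of_gap hgap hc.2 (lt_of_le_of_ne (Fin.le_last _) hc.1)
    left
    rcases h4 j hjx hjl with h6 | h6 <;> omega

lemma EarlyStage.lateStage {v : Perm (Fin (m + 1))} {a x : Fin (m + 1)} {k : ℕ}
    (h : EarlyStage v a x k) (hx : v x = x) : LateStage v x k := by
  obtain ⟨h1, h2, h3, h4⟩ := h
  refine ⟨hx, by omega, fun _ => by omega, fun j hjx hjl => ?_⟩
  rcases h4 j hjx hjl with h | h <;> omega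

/-- A gap contains at most `x`: the token of its largest other position would stay inside the gap
without passing its home. Hence the single extra step allowed by `LateStage`, taken only when
jumping over `x`. -/
lemma LateStage.torse {v : Perm (Fin (m + 1))} {x : Fin (m + 1)} {k : ℕ}
    (h : LateStage v x k) (hx : x < Fin.last m) (hvl : v (Fin.last m) < Fin.last m) :
    LateStage (torse v) x (k + 1) := by
  obtain ⟨h1, h2, h3, h4⟩ := h
  have hqx : v (Fin.last m) ≠ x := fun e => hx.ne' (v.injective (e.trans h1.symm))
  have hgap : ∀ b, v (Fin.last m) ≤ b → b < Fin.last m →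
      ∀ y, b < y → y < nextPerm (ncClosure v) b → y = x := by
    intro b hb hbl y hy hy'
    by_contra hyx
    set b' := nextPerm (ncClosure v) b
    obtain ⟨t, ⟨ht1, ht2, ht3⟩, hmax⟩ := Set.exists_max_image
      {t | b < t ∧ t < b' ∧ t ≠ x} id (Set.toFinite _) ⟨y, hy, hy', hyx⟩
    have h5 : b < v t ∧ v t < b' := gap_apply ht1 ht2
    have h6 : v t ≠ x := fun e => ht3 (v.injective (e.trans h1.symm))
    have h7 : v t ≤ t := hmax _ ⟨h5.1, h5.2, h6⟩
    have h8 := h4 t ht3 (by rw [Fin.lt_def, Fin.val_last]; omega)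
    omega
  have hXs : ∀ y, y = x → v y = y := fun y e => by rw [e, h1]
  have hl := lt_nextPerm_of_gap hgap le_rfl hvl hqx
  have hl' : ∀ p, v (Fin.last m) ≤ p → p < Fin.last m → p ≠ x →
      (nextPerm (ncClosure v) p : ℕ) ≤ p + 1 ∨
      (nextPerm (ncClosure v) p : ℕ) = p + 2 ∧ (x : ℕ) = p + 1 := by
    intro p hp hpl hpx
    by_contra! hcon
    have e1 := hgap p hp hpl ⟨p + 1, by omega⟩ (by rw [Fin.lt_def]; simp)
      (by rw [Fin.lt_def]; simp only; omega)
    have e1' := congrArg Fin.val e1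
    simp only at e1'
    have e2 := hgap p hp hpl ⟨p + 2, by omega⟩ (by rw [Fin.lt_def]; simp)
      (by rw [Fin.lt_def]; simp only; omega)
    have e2' := congrArg Fin.val e2
    simp only at e2'
    omega
  have hlv := hl' _ le_rfl hvl hqx
  refine ⟨torse_apply_of_fixed h1, by rw [torse_apply]; omega, ?_, fun j hjx hjl => ?_⟩
  · rw [torse_apply]; omega
  rw [torse_apply, torse_apply]
  have hne : v j ≠ v (Fin.last m) := v.injective.ne hjl.ne
  by_cases hc : v j = Fin.last m ∨ v j < v (Fin.last m)
  · right
    have := nextPerm_le_of_gap hgap hXs hc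
    omega
  · push Not at hc
    have hvx : v j ≠ x := fun e => hjx (v.injective (e.trans h1.symm))
    have h5 := lt_nextPerm_of_gap hgap hc.2 (lt_of_le_of_ne (Fin.le_last _) hc.1) hvx
    left
    rcases h4 j hjx hjl with h6 | h6 <;> omega

/-- The last token skips at most once when a single token ahead of it has not passed its home. -/
lemma torse_iterate_last_ne_of_descent (hm : 2 ≤ m) {u : Perm (Fin (m + 1))} {a x : Fin (m + 1)}
    (hx : x < Fin.last m) (h : EarlyStage u a x 0) (ha : u a ≤ x) :
    (torse^[m - 2] u) (Fin.last m) ≠ Fin.last m := by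
  have key : ∀ k, k ≤ m - 2 → EarlyStage (torse^[k] u) a x k ∨ LateStage (torse^[k] u) x k := by
    intro k
    induction k with
    | zero => exact fun _ => .inl h
    | succ k ih =>
      intro hk
      rw [Function.iterate_succ_apply']
      have hL : LateStage (torse^[k] u) x k → LateStage (torse (torse^[k] u)) x (k + 1) :=
        fun hl => hl.torse hx (by rw [Fin.lt_def, Fin.val_last]; have := hl.2.1; omega)
      rcases ih (by omega) with hE | hl
      · rcases hE.2.2.1.lt_or_eq with hlt | heq
        · exact .inl (hE.torse hx hlt fun hk0 => by subst hk0; exact ha)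
        · exact .inr (hL (hE.lateStage heq))
      · exact .inr (hL hl)
  intro e
  have e' : ((torse^[m - 2] u) (Fin.last m) : ℕ) = m := by rw [e, Fin.val_last]
  rcases key (m - 2) le_rfl with h1 | h1
  · have := h1.1; omega
  · have := h1.2.1; omega

/-! ### Slow sets are slow -/

/-- Rotation preserves the cyclic order; the linear order changes only at `Fin.last m`, which goes
to `0`. -/
lemma conj_incCycle (S : Finset (Fin (m + 1))) :
    finRotate (m + 1) * incCycle S * (finRotate (m + 1))⁻¹
      = incCycle (S.map (finRotate (m + 1)).toEmbedding) := by
  set c := finRotate (m + 1) with hc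
  have hcl : c (Fin.last m) = 0 := finRotate_last
  have hmem : ∀ y, c y ∈ S.map c.toEmbedding ↔ y ∈ S := fun y => by simp
  have hcc : ∀ y, (c * incCycle S * c⁻¹) (c y) = c (incCycle S y) := fun y => by simp
  refine Adapted.eq_nextPerm ⟨fun a' => ?_, fun a' b' hab hlt => ?_⟩
  · obtain ⟨a, rfl⟩ := c.surjective a'
    rw [hcc]
    by_cases ha : a ∈ S
    · exact .inr ⟨(hmem _).2 ha, (hmem _).2 (incCycle_mem ha)⟩
    · exact .inl (by rw [incCycle_of_notMem ha])
  · obtain ⟨a, rfl⟩ := c.surjective a'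
    obtain ⟨b, rfl⟩ := c.surjective b'
    rw [hcc]
    rcases hab with hab | ⟨ha, hb⟩
    · exact absurd hlt (hab ▸ lt_irrefl _)
    rw [hmem] at ha hb
    have hbl : b < Fin.last m := lt_of_le_of_ne (Fin.le_last _) fun e => by
      rw [e, hcl] at hlt
      exact absurd hlt (not_lt.2 (Fin.zero_le _))
    have hcb := finRotate_val hbl
    rw [← hc] at hcb
    rcases (Fin.le_last a).lt_or_eq with hal | rfl
    · have hca := finRotate_val hal
      rw [← hc] at hca
      have h1 := incCycle_lt ha hb (by omega)
      have h2 := finRotate_val (h1.2.trans_lt hbl)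
      rw [← hc] at h2
      omega
    · have h1 := incCycle_le_of_max ha (fun y _ => Fin.le_last y) hb
      have h2 := finRotate_val (h1.trans_lt hbl)
      rw [← hc] at h2
      rw [hcl, Fin.lt_def, Fin.le_def]
      simp only [Fin.val_zero]
      omega

lemma conj_pow_incCycle (S : Finset (Fin (m + 1))) (r : ℕ) :
    finRotate (m + 1) ^ r * (finRotate (m + 1) * incCycle S) * (finRotate (m + 1) ^ r)⁻¹
      = finRotate (m + 1) * incCycle (S.map (finRotate (m + 1) ^ r).toEmbedding) := by
  have h : finRotate (m + 1) ^ r * incCycle S * (finRotate (m + 1) ^ r)⁻¹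
      = incCycle (S.map (finRotate (m + 1) ^ r).toEmbedding) := by
    induction r with
    | zero =>
      have : S.map ((finRotate (m + 1)) ^ 0).toEmbedding = S := by
        ext y; simp [Perm.one_def]
      rw [this]; simp
    | succ r ih =>
      have h1 : S.map ((finRotate (m + 1)) ^ (r + 1)).toEmbedding
          = (S.map ((finRotate (m + 1)) ^ r).toEmbedding).map (finRotate (m + 1)).toEmbedding := by
        rw [Finset.map_map, pow_succ']; rfl
      rw [h1, ← conj_incCycle, ← ih, pow_succ']
      group
  rw [← h, ← mul_assoc, ← mul_assoc, ← mul_assoc, (Commute.pow_self (finRotate (m + 1)) r).eq]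

lemma isSlowSet_map (S : Finset (Fin (m + 1))) (r : ℕ) :
    IsSlowSet (S.map (finRotate (m + 1) ^ r).toEmbedding) ↔ IsSlowSet S := by
  unfold IsSlowSet
  rw [Finset.card_map]
  refine and_congr_right fun _ => imp_congr_right fun _ => ?_
  have h : ∀ a, finRotate (m + 1) ((finRotate (m + 1) ^ r) a)
      = (finRotate (m + 1) ^ r) (finRotate (m + 1) a) := fun a => by
    rw [← Perm.mul_apply, ← Perm.mul_apply, (Commute.pow_self (finRotate (m + 1)) r).eq]
  have hmem : ∀ y, (finRotate (m + 1) ^ r) y ∈ S.map (finRotate (m + 1) ^ r).toEmbedding ↔ y ∈ S :=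
    fun y => Finset.mem_map' _
  constructor
  · rintro ⟨a, ha, hca⟩
    obtain ⟨a, rfl⟩ := (finRotate (m + 1) ^ r).surjective a
    rw [h, hmem] at hca
    exact ⟨a, (hmem a).1 ha, hca⟩
  · rintro ⟨a, ha, hca⟩
    exact ⟨_, (hmem a).2 ha, by rwa [h, hmem]⟩

lemma torse_iterate_ne_one_of_conj {u : Perm (Fin (m + 1))} {k r : ℕ}
    (h : (torse^[k] (finRotate (m + 1) ^ r * u * (finRotate (m + 1) ^ r)⁻¹)) (Fin.last m)
      ≠ Fin.last m) : torse^[k] u ≠ 1 := by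
  intro e
  rw [torse_iterate_conj, e] at h
  simp at h

lemma torse_iterate_last_ne_of_mem (hm : 2 ≤ m) {S : Finset (Fin (m + 1))}
    (h0 : 0 ∈ S) (hl : Fin.last m ∈ S) :
    (torse^[m - 2] (finRotate (m + 1) * incCycle S)) (Fin.last m) ≠ Fin.last m := by
  have hzl : incCycle S (Fin.last m) = 0 :=
    le_antisymm (incCycle_le_of_max hl (fun y _ => Fin.le_last y) h0) (Fin.zero_le _)
  have h0l : (0 : Fin (m + 1)) < Fin.last m := by rw [Fin.lt_def]; simp; omega
  have hul : ((finRotate (m + 1) * incCycle S) (Fin.last m) : ℕ) = 1 := by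
    rw [Perm.mul_apply, hzl, finRotate_val h0l]; simp
  refine torse_iterate_last_ne_of_lt hm hul.le fun j _ hjl => ?_
  have hj : j ≤ incCycle S j := by
    by_cases hjS : j ∈ S
    · exact (incCycle_lt hjS hl hjl).1.le
    · rw [incCycle_of_notMem hjS]
  rcases (Fin.le_last (incCycle S j)).lt_or_eq with h1 | h1
  · left
    have := finRotate_val h1
    rw [Perm.mul_apply]
    omega
  · right
    rw [Fin.lt_def, hul, Perm.mul_apply, h1, finRotate_last]
    simp

lemma torse_iterate_last_ne_of_notMem (hm : 2 ≤ m) {S : Finset (Fin (m + 1))}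
    (hS : S = ∅ ∨ 2 < S.card) (hl : Fin.last m ∉ S) :
    (torse^[m - 2] (finRotate (m + 1) * incCycle S)) (Fin.last m) ≠ Fin.last m := by
  have hul : (finRotate (m + 1) * incCycle S) (Fin.last m) = 0 := by
    rw [Perm.mul_apply, incCycle_of_notMem hl, finRotate_last]
  have hzl : ∀ j, j < Fin.last m → incCycle S j < Fin.last m := fun j hj =>
    lt_of_le_of_ne (Fin.le_last _) fun e => by
      by_cases hjS : j ∈ S
      · exact hl (e ▸ incCycle_mem hjS)
      · rw [incCycle_of_notMem hjS] at e
        exact hj.ne e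
  have huj : ∀ j, j < Fin.last m →
      ((finRotate (m + 1) * incCycle S) j : ℕ) = incCycle S j + 1 := fun j hj =>
    finRotate_val (hzl j hj)
  rcases hS with rfl | hS
  · refine torse_iterate_last_ne_of_lt hm (by simp [hul]) fun j _ hjl => .inl ?_
    have := huj j hjl
    rw [incCycle_of_notMem (Finset.notMem_empty j)] at this
    omega
  obtain ⟨p, q, r, hp, hq, hr, hpq, hqr⟩ : ∃ p q r, p ∈ S ∧ q ∈ S ∧ r ∈ S ∧ p < q ∧ q < r := by
    let f := S.orderEmbOfFin rfl
    exact ⟨f ⟨0, by omega⟩, f ⟨1, by omega⟩, f ⟨2, by omega⟩, S.orderEmbOfFin_mem rfl _,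
      S.orderEmbOfFin_mem rfl _, S.orderEmbOfFin_mem rfl _, f.strictMono (by simp),
      f.strictMono (by simp)⟩
  obtain ⟨a, ha, hamin⟩ := Set.exists_min_image (S : Set (Fin (m + 1))) id (Set.toFinite _) ⟨p, hp⟩
  obtain ⟨x, hx, hxmax⟩ := Set.exists_max_image (S : Set (Fin (m + 1))) id (Set.toFinite _) ⟨p, hp⟩
  simp only [Finset.mem_coe, id] at ha hamin hx hxmax
  have hxl : x < Fin.last m := lt_of_le_of_ne (Fin.le_last _) fun e => hl (e ▸ hx)
  have haq : a < q := (hamin p hp).trans_lt hpq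
  have hqx : q < x := hqr.trans_le (hxmax r hr)
  have hzx : incCycle S x = a :=
    le_antisymm (incCycle_le_of_max hx hxmax ha) (hamin _ (incCycle_mem hx))
  have hux := huj x hxl
  rw [hzx] at hux
  refine torse_iterate_last_ne_of_descent hm (a := a) (x := x) hxl
    ⟨by simp [hul], by omega, by omega, fun j hjx hjl => .inl ?_⟩ ?_
  · have := huj j hjl
    have hj : j ≤ incCycle S j := by
      by_cases hjS : j ∈ S
      · exact (incCycle_lt hjS hx (lt_of_le_of_ne (hxmax j hjS) hjx)).1.le
      · rw [incCycle_of_notMem hjS]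
    omega
  -- The third element `q` enters here: it stops the cycle strictly before `x`. For a pair, `u a`
  -- would be `x + 1`.
  · have h1 := incCycle_lt ha hq haq
    have := huj a (by omega)
    omega

/-- Rotation chooses which token plays the last one: one that is away, for the first direction; for
the converse, the first element of an adjacent pair in `S`, or else an element outside `S`. -/
lemma torse_iterate_ne_one_iff (hm : 2 ≤ m) (u : Perm (Fin (m + 1))) :
    torse^[m - 2] u ≠ 1 ↔ ∃ S, IsSlowSet S ∧ u = finRotate (m + 1) * incCycle S := by
  constructor
  · intro h
    obtain ⟨r, hr⟩ := exists_conj_last_ne h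
    obtain ⟨S, hS, hu⟩ := exists_isSlowSet_of_last_ne hm hr
    have hmap : (S.map ((finRotate (m + 1)) ^ r).symm.toEmbedding).map
        ((finRotate (m + 1)) ^ r).toEmbedding = S := by ext y; simp
    refine ⟨S.map ((finRotate (m + 1)) ^ r).symm.toEmbedding, ?_, ?_⟩
    · rwa [← isSlowSet_map _ r, hmap]
    · rw [← hmap, ← conj_pow_incCycle] at hu
      exact mul_left_cancel (mul_right_cancel hu)
  · rintro ⟨S, ⟨hS1, hS2⟩, rfl⟩
    have hmem : ∀ r y, (finRotate (m + 1) ^ r) y ∈ S.map (finRotate (m + 1) ^ r).toEmbedding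
        ↔ y ∈ S := fun r y => Finset.mem_map' _
    by_cases hadj : ∃ a ∈ S, finRotate (m + 1) a ∈ S
    · obtain ⟨a, ha, hca⟩ := hadj
      obtain ⟨r, hr⟩ := exists_finRotate_pow a
      refine torse_iterate_ne_one_of_conj (r := r) ?_
      rw [conj_pow_incCycle]
      refine torse_iterate_last_ne_of_mem hm ?_ (hr ▸ (hmem r a).2 ha)
      have h0 : (finRotate (m + 1) ^ r) (finRotate (m + 1) a) = 0 := by
        rw [← Perm.mul_apply, (Commute.pow_self (finRotate (m + 1)) r).eq, Perm.mul_apply, hr,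
          finRotate_last]
      exact h0 ▸ (hmem r _).2 hca
    · have hcard : S = ∅ ∨ 2 < S.card := by
        rcases Finset.eq_empty_or_nonempty S with h | h
        · exact .inl h
        · have h1 := Finset.card_pos.2 h
          have h2 : S.card ≠ 2 := fun e => hadj (hS2 e)
          right; omega
      obtain ⟨v, hv⟩ : ∃ v, v ∉ S := by
        by_contra! hall
        exact hadj ⟨0, hall _, hall _⟩
      obtain ⟨r, hr⟩ := exists_finRotate_pow v
      refine torse_iterate_ne_one_of_conj (r := r) ?_
      rw [conj_pow_incCycle]
      refine torse_iterate_last_ne_of_notMem hm ?_ fun h => hv ((hmem r v).1 (hr ▸ h))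
      simpa using hcard

/-! ### Counting -/

lemma support_incCycle {S : Finset (Fin n)} (hS : S.card ≠ 1) : (incCycle S).support = S := by
  ext a
  rw [mem_support]
  refine ⟨fun h => by_contra fun ha => h (incCycle_of_notMem ha), fun ha h => hS ?_⟩
  refine Finset.card_eq_one.2 ⟨a, Finset.eq_singleton_iff_unique_mem.2 ⟨ha, fun b hb => ?_⟩⟩
  have h1 : (incCycle S).SameCycle a b := (adapted_incCycle S).sameCycle_iff.2 (.inr ⟨ha, hb⟩)
  exact (h1.eq_of_left h).symm

lemma finRotate_ne_self (hm : 2 ≤ m) (a : Fin (m + 1)) : finRotate (m + 1) a ≠ a := by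
  intro h
  have h1 := congrArg Fin.val h
  rw [coe_finRotate] at h1
  split_ifs at h1 with h2
  · rw [h2, Fin.val_last] at h1; omega
  · omega

lemma finRotate_finRotate_ne_self (hm : 2 ≤ m) (a : Fin (m + 1)) :
    finRotate (m + 1) (finRotate (m + 1) a) ≠ a := by
  intro h
  have h1 := congrArg Fin.val h
  rw [coe_finRotate] at h1
  split_ifs at h1 with h2
  · have h3 := congrArg Fin.val h2
    rw [coe_finRotate, Fin.val_last] at h3
    split_ifs at h3 with h4 <;> omega
  · rw [coe_finRotate] at h1
    split_ifs at h1 with h4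
    · rw [h4, Fin.val_last] at h1; omega
    · omega

open Classical in
lemma card_adjacent_pairs (hm : 2 ≤ m) :
    (Finset.univ.filter fun S : Finset (Fin (m + 1)) =>
      S.card = 2 ∧ ∃ a ∈ S, finRotate (m + 1) a ∈ S).card = m + 1 := by
  have h : (Finset.univ.filter fun S : Finset (Fin (m + 1)) =>
      S.card = 2 ∧ ∃ a ∈ S, finRotate (m + 1) a ∈ S)
      = Finset.univ.image fun a => {a, finRotate (m + 1) a} := by
    ext S
    simp only [Finset.mem_filter, Finset.mem_univ, true_and, Finset.mem_image]
    constructor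
    · rintro ⟨h2, a, ha, hca⟩
      refine ⟨a, Finset.eq_of_subset_of_card_le ?_ ?_⟩
      · intro y hy
        rcases Finset.mem_insert.1 hy with rfl | hy
        · exact ha
        · rwa [Finset.mem_singleton.1 hy]
      · rw [h2, Finset.card_pair (finRotate_ne_self hm a).symm]
    · rintro ⟨a, rfl⟩
      exact ⟨Finset.card_pair (finRotate_ne_self hm a).symm, a, by simp, by simp⟩
  rw [h, Finset.card_image_of_injective, Finset.card_univ, Fintype.card_fin]
  intro a b hab
  simp only at hab
  by_contra hne
  have h1 : a ∈ ({b, finRotate (m + 1) b} : Finset _) := hab ▸ Finset.mem_insert_self _ _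
  have h2 : b ∈ ({a, finRotate (m + 1) a} : Finset _) := hab ▸ Finset.mem_insert_self _ _
  simp only [Finset.mem_insert, Finset.mem_singleton] at h1 h2
  have h1' := h1.resolve_left hne
  have h2' := h2.resolve_left (Ne.symm hne)
  rw [h2'] at h1'
  -- Distinct elements give distinct adjacent pairs because `n ≥ 3` keeps the square of the rotation
  -- free of fixed points.
  exact finRotate_finRotate_ne_self hm a h1'.symm

lemma ncard_isSlowSet (hm : 2 ≤ m) :
    ({S : Finset (Fin (m + 1)) | IsSlowSet S}.ncard : ℤ)
      = 2 ^ (m + 1) - ((m + 1).choose 2 : ℤ) := by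
  classical
  have hk : ∀ k, (Finset.univ.filter fun S : Finset (Fin (m + 1)) => S.card = k).card
      = (m + 1).choose k := fun k => by
    rw [← Finset.powerset_univ, ← Finset.powersetCard_eq_filter, Finset.card_powersetCard,
      Finset.card_univ, Fintype.card_fin]
  have h0 : ({S : Finset (Fin (m + 1)) | IsSlowSet S}.ncard)
      = (Finset.univ.filter fun S : Finset (Fin (m + 1)) => IsSlowSet S).card := by
    rw [← Set.ncard_coe_finset]; congr 1; ext S; simp
  have h1 := Finset.card_filter_add_card_filter_not (s := Finset.univ)
    (fun S : Finset (Fin (m + 1)) => IsSlowSet S)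
  have h2 : (Finset.univ.filter fun S : Finset (Fin (m + 1)) => ¬ IsSlowSet S)
      = (Finset.univ.filter fun S : Finset (Fin (m + 1)) => S.card = 1) ∪
        (Finset.univ.filter fun S : Finset (Fin (m + 1)) => S.card = 2 ∧
          ¬ ∃ a ∈ S, finRotate (m + 1) a ∈ S) := by
    ext S
    simp only [Finset.mem_filter, Finset.mem_univ, true_and, Finset.mem_union]
    unfold IsSlowSet
    rw [not_and_or, not_not, Classical.not_imp]
  have h3 := Finset.card_filter_add_card_filter_not
    (s := Finset.univ.filter fun S : Finset (Fin (m + 1)) => S.card = 2)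
    (fun S : Finset (Fin (m + 1)) => ∃ a ∈ S, finRotate (m + 1) a ∈ S)
  rw [Finset.filter_filter, Finset.filter_filter, hk, card_adjacent_pairs hm] at h3
  rw [h2, Finset.card_union_of_disjoint, hk, Nat.choose_one_right, Finset.card_univ,
    Fintype.card_finset, Fintype.card_fin] at h1
  · rw [h0]
    have h4 : ((2 ^ (m + 1) : ℕ) : ℤ) = 2 ^ (m + 1) := by push_cast; rfl
    rw [← h4]
    omega
  · rw [Finset.disjoint_left]
    intro S hS hS'
    simp only [Finset.mem_filter, Finset.mem_univ, true_and] at hS hS'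
    omega

lemma requiresExactly_iff (hm : 2 ≤ m) (w : Perm (Fin (m + 1))) :
    (RequiresExactly (finRotate (m + 1)) w (m - 1) ∨ RequiresExactly (finRotate (m + 1)) w m)
      ↔ torse^[m - 2] w⁻¹ ≠ 1 := by
  have hset : ∀ k, (popT (finRotate (m + 1)))^[k] w = 1 ↔ torse^[k] w⁻¹ = 1 := fun k => by
    rw [popT_iterate_eq_torse, inv_eq_one]
  have hmono : ∀ k k', k ≤ k' → torse^[k] w⁻¹ = 1 → torse^[k'] w⁻¹ = 1 := fun k k' hk h => by
    ext j
    rw [torse_iterate_eq_of_fixed w⁻¹ hk (j := j) (by rw [h]; rfl)]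
    rfl
  unfold RequiresExactly
  simp only [hset]
  constructor
  · rintro (h | h) e
    · have := h.2 e; omega
    · have := h.2 e; omega
  · intro h
    have hlow : ∀ k, torse^[k] w⁻¹ = 1 → m - 1 ≤ k := fun k hk => by
      by_contra! hlt
      exact h (hmono k (m - 2) (by omega) hk)
    by_cases h1 : torse^[m - 1] w⁻¹ = 1
    · exact .inl ⟨h1, hlow⟩
    · refine .inr ⟨torse_iterate_m _, fun k hk => ?_⟩
      have h2 := hlow k hk
      have h3 : k ≠ m - 1 := fun e => h1 (e ▸ hk)
      omega

lemma popT_iterate_conj (g w : Perm (Fin (m + 1))) (k : ℕ) :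
    (popT (g * finRotate (m + 1) * g⁻¹))^[k] (g * w * g⁻¹)
      = g * (popT (finRotate (m + 1)))^[k] w * g⁻¹ := by
  induction k with
  | zero => rfl
  | succ k ih => rw [Function.iterate_succ_apply', ih, popT_conj, Function.iterate_succ_apply']

lemma requiresExactly_conj (g w : Perm (Fin (m + 1))) (k : ℕ) :
    RequiresExactly (g * finRotate (m + 1) * g⁻¹) (g * w * g⁻¹) k
      ↔ RequiresExactly (finRotate (m + 1)) w k := by
  unfold RequiresExactly
  simp only [popT_iterate_conj, conj_eq_one_iff]

end PopTsack

/-- Here `c` is any `n`-cycle. These are the Coxeter elements of `𝔖_n` (for all choices of simple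
reflections); `c = (1 2 ⋯ n)`, that is `finRotate n`, is one of them. -/
theorem corollary2p2 (n : ℕ) (hn : 3 ≤ n) (c : Equiv.Perm (Fin n))
    (hc : c.IsCycle) (hsupp : c.support = Finset.univ) :
    (Set.ncard {w : Equiv.Perm (Fin n) |
        PopTsack.RequiresExactly c w (n - 2) ∨ PopTsack.RequiresExactly c w (n - 1)} : ℤ)
      = 2 ^ n - (n.choose 2 : ℤ) := by
  obtain ⟨m, rfl⟩ : ∃ m, n = m + 1 := ⟨n - 1, by omega⟩
  have hm : 2 ≤ m := by omega
  obtain ⟨g, rfl⟩ : ∃ g, g * finRotate (m + 1) * g⁻¹ = c :=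
    isConj_iff.1 ((isCycle_finRotate_of_le (by omega)).isConj hc
      (by rw [hsupp, support_finRotate_of_le (by omega)]))
  have e1 : m + 1 - 2 = m - 1 := by omega
  have e2 : m + 1 - 1 = m := by omega
  rw [e1, e2, ← PopTsack.ncard_isSlowSet hm]
  congr 1
  let F : Finset (Fin (m + 1)) → Equiv.Perm (Fin (m + 1)) := fun S =>
    g * (finRotate (m + 1) * PopTsack.incCycle S)⁻¹ * g⁻¹
  have hF : {w : Equiv.Perm (Fin (m + 1)) |
      PopTsack.RequiresExactly (g * finRotate (m + 1) * g⁻¹) w (m - 1) ∨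
        PopTsack.RequiresExactly (g * finRotate (m + 1) * g⁻¹) w m}
      = F '' {S | PopTsack.IsSlowSet S} := by
    ext w
    obtain ⟨w, rfl⟩ : ∃ w', g * w'⁻¹ * g⁻¹ = w := ⟨(g⁻¹ * w * g)⁻¹, by group⟩
    simp only [Set.mem_ofPred_eq, Set.mem_image, F]
    rw [PopTsack.requiresExactly_conj, PopTsack.requiresExactly_conj,
      PopTsack.requiresExactly_iff hm, inv_inv, PopTsack.torse_iterate_ne_one_iff hm]
    refine exists_congr fun S => and_congr_right fun _ => ?_
    rw [mul_left_inj, mul_right_inj, inv_inj, eq_comm]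
  rw [hF]
  refine Set.InjOn.ncard_image fun S hS S' hS' h => ?_
  -- A slow set is recovered as the support of its cycle, since singletons are excluded.
  have h1 : PopTsack.incCycle S = PopTsack.incCycle S' := by simpa [F] using h
  rw [← PopTsack.support_incCycle hS.1, h1, PopTsack.support_incCycle hS'.1]
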